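/- Let $n\ge 2$ be an integer, $k\in\mathbb C$, $\gamma:=nk$, and assume $\mathrm{Re}(\gamma)>0$. Identify $\mathbb R^2$ with $\mathbb C$ and let $\langle\cdot,\cdot\rangle$ be the canonical inner product of $\mathbb R^2$. Put $w=e^{i\pi/n}$, and let $\mathcal D_n$ be the dihedral group of order $2n$, consisting of the maps $r^j$ and $r^j\sigma$, $0\le j\le n-1$, where $r(x)=w^2x$ and $\sigma(x)=\overline x$. Its positive roots are $R_+=\{iw^j: 0\le j\le n-1\}$. For $\xi\in\mathbb R^2$ let $$T_\xi f(x)=\partial_\xi f(x)+k\sum_{\alpha\in R_+}\langle\alpha,\xi\rangle\frac{f(x)-f(\sigma_\alpha x)}{\langle\alpha,x\rangle},\qquad f\in C^1(\mathbb R^2,\mathbb C),$$ be the Dunkl operators with constant parameter $k$; here $\sigma_\alpha$ is the orthogonal reflection in $\alpha^\perp$, and the quotient is replaced by its limit value where $\langle\alpha,x\rangle=0$. Under these assumptions there is a unique linear automorphism $V_k$ of the space of complex polynomials on $\mathbb R^2$ that maps homogeneous polynomials of degree $m$ to homogeneous polynomials of degree $m$ for every $m$, and satisfies $V_k1=1$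 and $T_\xi V_k=V_k\partial_\xi$ for all $\xi$. Put $E_m(x,y)=\frac1{m!}V_k(\langle\cdot,y\rangle^m)(x)$. For each $y\in\mathbb R^2$ there is also a unique $C^1$ function $E_k(\cdot,y)$ on $\mathbb R^2$ with $E_k(0,y)=1$ and $T_\xi E_k(\cdot,y)=\langle\xi,y\rangle E_k(\cdot,y)$ for all $\xi$, the Dunkl kernel. For $x,y\in\mathbb R^2$ let $a(x,y)=\max_{g\in\mathcal D_n}|\langle gx,y\rangle|$ (with $1/0:=+\infty$ below). For $p\ge0$ put $S^{\pm}_p=\sum_{j=0}^{n-1}\left(\langle r^jx,y\rangle^{p+1}\pm\langle r^j\sigma x,y\rangle^{p+1}\right)$ and $$B_p=\frac{\gamma}{2n}\begin{bmatrix}S^+_p&-S^-_p\\ S^-_p&-S^+_p\end{bmatrix},\qquad A_0=\begin{bmatrix}\frac{2n}{\gamma}\\0\end{bmatrix},\qquad A_p=\begin{bmatrix}\frac1p&0\\0&\frac1{p+2\gamma}\end{bmatrix}\sum_{i=0}^{p-1}B_{p-i-1}A_i\quad(p\ge1),$$ and let $Q(z,x,y)=(Q_1,Q_2)=\sum_{p\ge1}A_pz^p$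 and $\Phi(z,x,y)=\frac{2n}{\gamma}+Q_1(z,x,y)-Q_2(z,x,y)$. Let $\mathcal J$ be the set of all real $\delta\ge1$ such that for all $x,y\in\mathbb R^2$ the series defining $Q(z,x,y)$ converges for $|z|<\frac1{\delta a(x,y)}$ and $$E_m(x,y)=\frac{\gamma/2n}{(1+\gamma)_m}\,\frac1{2i\pi}\int_{|z|=\rho}\frac{\Phi(z,x,y)}{1-z\langle x,y\rangle}\frac{dz}{z^{m+1}}\qquad\text{for all } m\ge0,\ 0<\rho<\tfrac1{\delta a(x,y)},$$ where $(\cdot)_m$ is the Pochhammer symbol. Then $\mathcal J$ is nonempty and contains with each $\delta$ every $\delta'\ge\delta$. Moreover, for all $\delta\in\mathcal J$, $x,y\in\mathbb R^2$ and $0<\rho<\frac1{\delta a(x,y)}$, $$E_k(x,y)=\int_0^1(1-t)^{\gamma-1}\,\mathrm K(t,\delta,\rho,x,y)\,dt,\qquad \mathrm K(t,\delta,\rho,x,y):=\frac{\gamma^2}{2n}\,\frac1{2i\pi}\int_{|z|=\rho}\frac{\Phi(z,x,y)}{z(1-z\langle x,y\rangle)}\,e^{t/z}\,dz,$$ where both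 integrals are absolutely convergent. -/

import Mathlib

open scoped ComplexConjugate InnerProductSpace

noncomputable section

namespace Dunkl

/-! The plane `ℝ²` is identified with `ℂ`; `⟪x, y⟫_ℝ = Re (conj x * y)` is the canonical inner
product of `ℝ²`. -/

/-- The number `w = exp (i π / n)`. -/
def w (n : ℕ) : ℂ := Complex.exp (Real.pi * Complex.I / n)

/-- The positive roots `i w ^ j`, `j = 0, …, n - 1`, of the dihedral group of order `2 n`. -/
def root (n : ℕ) (j : Fin n) : ℂ := Complex.I * w n ^ (j : ℕ)

/-- The orthogonal reflection of the plane in the line orthogonal to `α`. -/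
def reflection (α x : ℂ) : ℂ := x - (2 * ⟪x, α⟫_ℝ / ‖α‖ ^ 2 : ℝ) • α

/-- The `j`-th power of the rotation `r : x ↦ w ^ 2 * x`. -/
def rot (n : ℕ) (j : Fin n) (x : ℂ) : ℂ := w n ^ (2 * (j : ℕ)) * x

/-- The reflection `σ`, i.e. complex conjugation. The dihedral group of order `2 n` consists of
the maps `rot n j` and `rot n j ∘ sigma`. -/
def sigma (x : ℂ) : ℂ := conj x

/-- `γ = n k`, the sum over the positive roots of the constant parameter function `k`. -/
def gam (n : ℕ) (k : ℂ) : ℂ := n * k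

/-- The Dunkl operator `T_ξ` of the dihedral group of order `2 n` with constant parameter `k`,
acting on `C¹` functions on the plane. Where `⟪α, x⟫ = 0`, the difference quotient
`(f x - f (σ_α x)) / ⟪α, x⟫` is replaced by its limit value `(2 / ‖α‖ ^ 2) ∂_α f x`. -/
def dunklOp (n : ℕ) (k : ℂ) (ξ : ℂ) (f : ℂ → ℂ) (x : ℂ) : ℂ :=
  fderiv ℝ f x ξ + ∑ j : Fin n, k * (⟪root n j, ξ⟫_ℝ : ℂ) *
    (if ⟪root n j, x⟫_ℝ = 0 then (2 / ‖root n j‖ ^ 2 : ℝ) * fderiv ℝ f x (root n j)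
     else (f x - f (reflection (root n j) x)) / (⟪root n j, x⟫_ℝ : ℂ))

/-- The function on the plane given by a complex polynomial in two variables. -/
def polyFun (p : MvPolynomial (Fin 2) ℂ) (x : ℂ) : ℂ :=
  MvPolynomial.eval ![(x.re : ℂ), (x.im : ℂ)] p

/-- The directional derivative `∂_ξ` on polynomials. -/
def polyDeriv (ξ : ℂ) (p : MvPolynomial (Fin 2) ℂ) : MvPolynomial (Fin 2) ℂ :=
  (ξ.re : ℂ) • MvPolynomial.pderiv 0 p + (ξ.im : ℂ) • MvPolynomial.pderiv 1 p

/-- The linear polynomial `⟨·, y⟩`. -/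
def linPoly (y : ℂ) : MvPolynomial (Fin 2) ℂ :=
  (y.re : ℂ) • MvPolynomial.X 0 + (y.im : ℂ) • MvPolynomial.X 1

/-- `V` is a Dunkl intertwining operator: a linear automorphism of the space of polynomials that
preserves homogeneous polynomials and their degree, fixes `1`, and satisfies
`T_ξ V = V ∂_ξ` for all `ξ`. -/
structure IsIntertwining (n : ℕ) (k : ℂ)
    (V : MvPolynomial (Fin 2) ℂ →ₗ[ℂ] MvPolynomial (Fin 2) ℂ) : Prop where
  bijective : Function.Bijective V
  isHomogeneous : ∀ (m : ℕ) (p : MvPolynomial (Fin 2) ℂ),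
    p.IsHomogeneous m → (V p).IsHomogeneous m
  map_one : V 1 = 1
  intertwines : ∀ (ξ : ℂ) (p : MvPolynomial (Fin 2) ℂ) (x : ℂ),
    dunklOp n k ξ (polyFun (V p)) x = polyFun (V (polyDeriv ξ p)) x

/-- The intertwining operator `V_k`. -/
def intertwiningOp (n : ℕ) (k : ℂ) : MvPolynomial (Fin 2) ℂ →ₗ[ℂ] MvPolynomial (Fin 2) ℂ :=
  Classical.epsilon (IsIntertwining n k)

/-- The polynomials `E_m(x, y) = V_k (⟨·, y⟩ ^ m) (x) / m!`. -/
def dunklE (n : ℕ) (k : ℂ) (m : ℕ) (x y : ℂ) : ℂ :=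
  1 / (m.factorial : ℂ) * polyFun (intertwiningOp n k (linPoly y ^ m)) x

/-- The conditions that characterize the Dunkl kernel `f = E_k(·, y)`. -/
structure IsDunklKernel (n : ℕ) (k : ℂ) (y : ℂ) (f : ℂ → ℂ) : Prop where
  contDiff : ContDiff ℝ 1 f
  map_zero : f 0 = 1
  eigen : ∀ ξ x : ℂ, dunklOp n k ξ f x = (⟪ξ, y⟫_ℝ : ℂ) * f x

/-- The Dunkl kernel `E_k(x, y)`. -/
def dunklKernel (n : ℕ) (k : ℂ) (x y : ℂ) : ℂ :=
  Classical.epsilon (IsDunklKernel n k y) x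

/-- `a(x, y)`, the maximum of `|⟨g x, y⟩|` over the elements `g` of the dihedral group. -/
def a (n : ℕ) (x y : ℂ) : ℝ :=
  ⨆ j : Fin n, max |⟪rot n j x, y⟫_ℝ| |⟪rot n j (sigma x), y⟫_ℝ|

/-- The sum of the powers `⟨g x, y⟩ ^ p` over the rotations `g`. -/
def rotSum (n : ℕ) (p : ℕ) (x y : ℂ) : ℂ := ∑ j : Fin n, (⟪rot n j x, y⟫_ℝ : ℂ) ^ p

/-- The sum of the powers `⟨g x, y⟩ ^ p` over the reflections `g`. -/
def reflSum (n : ℕ) (p : ℕ) (x y : ℂ) : ℂ := ∑ j : Fin n, (⟪rot n j (sigma x), y⟫_ℝ : ℂ) ^ p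

/-- The matrices `B_p(x, y)`. -/
def matB (n : ℕ) (k : ℂ) (p : ℕ) (x y : ℂ) : Matrix (Fin 2) (Fin 2) ℂ :=
  (gam n k / (2 * n)) •
    !![rotSum n (p + 1) x y + reflSum n (p + 1) x y,
        -(rotSum n (p + 1) x y - reflSum n (p + 1) x y);
       rotSum n (p + 1) x y - reflSum n (p + 1) x y,
        -(rotSum n (p + 1) x y + reflSum n (p + 1) x y)]

/-- The vectors `A_p(x, y)`: `A_0 = (2 n / γ, 0)` and, for `p ≥ 1`,
`A_p = diag (1 / p, 1 / (p + 2 γ)) ∑_{i < p} B_{p - i - 1} A_i`. -/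
def vecA (n : ℕ) (k : ℂ) (x y : ℂ) : ℕ → (Fin 2 → ℂ)
  | 0 => ![2 * n / gam n k, 0]
  | p + 1 =>
    Matrix.mulVec (Matrix.diagonal ![1 / ((p : ℂ) + 1), 1 / ((p : ℂ) + 1 + 2 * gam n k)])
      (∑ i : Fin (p + 1), Matrix.mulVec (matB n k (p - i) x y) (vecA n k x y i))

/-- `Q(z, x, y) = ∑_{p ≥ 1} A_p(x, y) z ^ p`. -/
def Q (n : ℕ) (k : ℂ) (z x y : ℂ) : Fin 2 → ℂ :=
  ∑' p : ℕ, z ^ (p + 1) • vecA n k x y (p + 1)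

/-- `Φ(z, x, y) = 2 n / γ + Q₁(z, x, y) - Q₂(z, x, y)`. -/
def Phi (n : ℕ) (k : ℂ) (z x y : ℂ) : ℂ :=
  2 * n / gam n k + Q n k z x y 0 - Q n k z x y 1

/-- The set `𝒥(k, n)` of all `δ ≥ 1` such that, for all `x` and `y`, the series `Q(z, x, y)`
converges for `|z| < 1 / (δ a(x, y))` and
`E_m(x, y) = (γ / 2 n) / (1 + γ)_m * (1 / 2 i π) ∮_{|z| = ρ} Φ(z, x, y) / (1 - z ⟨x, y⟩) dz / z ^ (m + 1)`
for all `m` and all `0 < ρ < 1 / (δ a(x, y))`. The convention `1 / 0 = ∞` is in force, so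
`ρ < 1 / (δ a(x, y))` is written as `ρ * (δ * a(x, y)) < 1`. -/
def admissible (n : ℕ) (k : ℂ) : Set ℝ :=
  {δ | 1 ≤ δ ∧ ∀ x y : ℂ,
    (∀ z : ℂ, ‖z‖ * (δ * a n x y) < 1 →
      Summable fun p : ℕ => z ^ (p + 1) • vecA n k x y (p + 1)) ∧
    ∀ ρ : ℝ, 0 < ρ → ρ * (δ * a n x y) < 1 → ∀ m : ℕ,
      dunklE n k m x y =
        (gam n k / (2 * n)) / (ascPochhammer ℂ m).eval (1 + gam n k) *
          (1 / (2 * Real.pi * Complex.I) *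
            ∮ z in C(0, ρ), Phi n k z x y / (1 - z * (⟪x, y⟫_ℝ : ℂ)) / z ^ (m + 1))}

/-- The function under the contour integral that defines the kernel `K`. -/
def integrand (n : ℕ) (k : ℂ) (t : ℝ) (x y z : ℂ) : ℂ :=
  Phi n k z x y / (z * (1 - z * (⟪x, y⟫_ℝ : ℂ))) * Complex.exp (t / z)

/-- The kernel `K(t, δ, ρ, x, y)`; `δ` only restricts the range of `ρ`. -/
def kernelK (n : ℕ) (k : ℂ) (t ρ : ℝ) (x y : ℂ) : ℂ :=
  gam n k ^ 2 / (2 * n) *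
    (1 / (2 * Real.pi * Complex.I) * ∮ z in C(0, ρ), integrand n k t x y z)

end Dunkl

end

noncomputable section

namespace Dunkl

/-! ### The dihedral group -/

/-! Everything rests on the radial operator `∑ xᵢ T_{eᵢ}`. The denominators cancel in it, and on
polynomials of degree `m` it becomes `m + γ - k S`, where `S` is the sum of the `n` reflections
(`dunklOp_self`, `X_mul_dunkl`). A product of three reflections is a reflection, so `S³ = n² S`.
Hence `m + γ - k S` can only have the eigenvalues `m + γ`, `m` and `m + 2γ`. For `m ≥ 1` and `Re γ >
0` none of them is zero, and the inverse is an explicit quadratic polynomial in `S` (`resolvent`).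

The intertwining operator is therefore forced degree by degree: `(m + γ - k S) V p = ∑ xᵢ V (∂ᵢ p)`.
Conversely, the operator defined by this recursion intertwines. Applying the Dunkl operators to the
recursion shows that the fields `(Tᵢ V p)` and `(V ∂ᵢ p)` solve one linear system, which is
injective for the same algebraic reason (`dunkl_interDeg`).

For analysis the radial operator is restricted to a single orbit. There `γ - k S = k (n - S)` has
nonnegative real part (`orbit_accretive`). This gives `|E_m| ≤ 2n (|x||y|)^m / m!`, so that `∑ E_m`
converges to a Dunkl kernel, and a Grönwall argument along rays gives its uniqueness
(`eq_zero_of_radial_equation`).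

On the orbit of `x`, the radial recursion for `E_m` is solved by convolutions: `(1 + γ)_m E_m(x, y)
= ∑ cᵢ ⟨x, y⟩^(m - i)`, where the `cᵢ` are the Taylor coefficients of `(γ / 2n) Φ` (`sum_coeff_eq`).
Thus `(γ / 2n) Φ / (1 - z⟨x, y⟩)` generates the `(1 + γ)_m E_m`, and geometric bounds on `A_p` turn
this into the contour formula.

Finally, expanding `exp (t / z)` gives `K(t) = ∑ γ (1 + γ)_m E_m t^m / m!`, and the Beta integral `∫
(1 - t)^(γ - 1) t^m dt = m! / (γ (1 + γ)_m)` turns the integral of `(1 - t)^(γ - 1) K(t)` into `∑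
E_m = E_k`. -/

/-- The factor `w ^ (2 j)` of the rotation `rot n j`. -/
def omega (n : ℕ) (j : Fin n) : ℂ := w n ^ (2 * (j : ℕ))

lemma rot_eq (n : ℕ) (j : Fin n) (x : ℂ) : rot n j x = omega n j * x := rfl

lemma norm_w (n : ℕ) : ‖w n‖ = 1 := by
  have : (Real.pi * Complex.I / n : ℂ) = ((Real.pi / n : ℝ) : ℂ) * Complex.I := by
    push_cast; ring
  rw [w, this, Complex.norm_exp_ofReal_mul_I]

lemma w_ne_zero (n : ℕ) : w n ≠ 0 := Complex.exp_ne_zero _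

lemma w_pow (n : ℕ) [NeZero n] : w n ^ (2 * n) = 1 := by
  have hn : (n : ℂ) ≠ 0 := Nat.cast_ne_zero.2 (NeZero.ne n)
  rw [w, ← Complex.exp_nat_mul, ← Complex.exp_two_pi_mul_I]
  congr 1
  push_cast
  field_simp

lemma norm_omega (n : ℕ) (j : Fin n) : ‖omega n j‖ = 1 := by
  rw [omega, norm_pow, norm_w, one_pow]

lemma omega_ne_zero (n : ℕ) (j : Fin n) : omega n j ≠ 0 := pow_ne_zero _ (w_ne_zero n)

lemma conj_omega (n : ℕ) (j : Fin n) : conj (omega n j) = (omega n j)⁻¹ := by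
  rw [Complex.inv_def, Complex.normSq_eq_norm_sq, norm_omega]
  simp

lemma omega_zero (n : ℕ) [NeZero n] : omega n 0 = 1 := by simp [omega]

lemma omega_add (n : ℕ) [NeZero n] (i j : Fin n) : omega n (i + j) = omega n i * omega n j := by
  have h : ∀ a : ℕ, w n ^ (2 * a) = w n ^ (2 * (a % n)) := fun a => by
    conv_lhs => rw [← Nat.div_add_mod a n]
    rw [mul_add, pow_add, ← mul_assoc, pow_mul (w n) (2 * n), w_pow, one_pow, one_mul]
  rw [omega, omega, omega, Fin.val_add, ← h, mul_add, pow_add]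

lemma omega_neg (n : ℕ) [NeZero n] (j : Fin n) : omega n (-j) = (omega n j)⁻¹ := by
  refine eq_inv_of_mul_eq_one_left ?_
  rw [← omega_add, neg_add_cancel, omega_zero]

lemma omega_sub (n : ℕ) [NeZero n] (i j : Fin n) :
    omega n (i - j) = omega n i * (omega n j)⁻¹ := by
  rw [sub_eq_add_neg, omega_add, omega_neg]

lemma sum_omega_mul (n : ℕ) [NeZero n] (f : ℂ → ℂ) (i : Fin n) (x : ℂ) :
    ∑ j, f (omega n j * (omega n i * x)) = ∑ j, f (omega n j * x) := by
  rw [← Equiv.sum_comp (Equiv.addRight i) (fun j => f (omega n j * x))]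
  refine Finset.sum_congr rfl fun j _ => ?_
  rw [Equiv.coe_addRight, omega_add, mul_assoc]

lemma sum_omega_mul_conj (n : ℕ) [NeZero n] (f : ℂ → ℂ) (i : Fin n) (x : ℂ) :
    ∑ j, f (omega n j * conj (omega n i * x)) = ∑ j, f (omega n j * conj x) := by
  rw [map_mul, conj_omega, ← omega_neg, sum_omega_mul]

lemma norm_root (n : ℕ) (j : Fin n) : ‖root n j‖ = 1 := by
  rw [root, norm_mul, norm_pow, norm_w, Complex.norm_I, one_pow, one_mul]

lemma ofReal_inner (x y : ℂ) : ((⟪x, y⟫_ℝ : ℝ) : ℂ) = (conj x * y + x * conj y) / 2 := by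
  rw [Complex.inner, Complex.re_eq_add_conj]
  simp only [map_mul, Complex.conj_conj]
  ring

lemma conj_w (n : ℕ) : conj (w n) = (w n)⁻¹ := by
  rw [Complex.inv_def, Complex.normSq_eq_norm_sq, norm_w]
  simp

lemma ofReal_inner_root (n : ℕ) (j : Fin n) (x : ℂ) :
    ((⟪root n j, x⟫_ℝ : ℝ) : ℂ) =
      -(Complex.I / 2 * (w n ^ (j : ℕ))⁻¹) * (x - omega n j * conj x) := by
  have := pow_ne_zero (j : ℕ) (w_ne_zero n)
  rw [ofReal_inner, root, omega, map_mul, map_pow, conj_w, Complex.conj_I, inv_pow, mul_comm 2,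
    pow_mul]
  field_simp
  ring

lemma reflection_root (n : ℕ) (j : Fin n) (x : ℂ) :
    reflection (root n j) x = omega n j * conj x := by
  have := pow_ne_zero (j : ℕ) (w_ne_zero n)
  rw [reflection, norm_root, real_inner_comm, Complex.real_smul]
  push_cast
  rw [ofReal_inner_root, root, omega, mul_comm 2, pow_mul]
  field_simp
  rw [Complex.I_sq]
  ring

lemma inner_root_eq_zero_iff (n : ℕ) (j : Fin n) (x : ℂ) :
    ⟪root n j, x⟫_ℝ = 0 ↔ omega n j * conj x = x := by
  rw [← Complex.ofReal_eq_zero, ofReal_inner_root, mul_eq_zero, sub_eq_zero, eq_comm (a := x)]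
  have := pow_ne_zero (j : ℕ) (w_ne_zero n)
  simp [this]

/-- The operator `∑ xᵢ T_{eᵢ}`. -/
lemma dunklOp_self (n : ℕ) (k : ℂ) (f : ℂ → ℂ) (x : ℂ) :
    dunklOp n k x f x =
      fderiv ℝ f x x + gam n k * f x - k * ∑ j : Fin n, f (omega n j * conj x) := by
  have h : ∀ j : Fin n, k * (⟪root n j, x⟫_ℝ : ℂ) *
    (if ⟪root n j, x⟫_ℝ = 0 then (2 / ‖root n j‖ ^ 2 : ℝ) * fderiv ℝ f x (root n j)
     else (f x - f (reflection (root n j) x)) / (⟪root n j, x⟫_ℝ : ℂ)) =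
      k * f x - k * f (omega n j * conj x) := by
    intro j
    split_ifs with hj
    -- On the mirror the factor `⟪α, x⟫` kills the limit value, and `σ_α x = x` makes the right-hand
    -- side vanish too.
    · rw [hj, (inner_root_eq_zero_iff n j x).1 hj]; simp
    · rw [reflection_root]
      have : ((⟪root n j, x⟫_ℝ : ℝ) : ℂ) ≠ 0 := Complex.ofReal_ne_zero.2 hj
      field_simp
  rw [dunklOp, Finset.sum_congr rfl fun j _ => h j, Finset.sum_sub_distrib, Finset.sum_const,
    Finset.card_univ, Fintype.card_fin, ← Finset.mul_sum, gam, nsmul_eq_mul]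
  ring

/-! ### Positivity on orbits -/

lemma norm_sum_sq_le {n : ℕ} (u : Fin n → ℂ) : ‖∑ j, u j‖ ^ 2 ≤ n * ∑ j, ‖u j‖ ^ 2 := by
  calc ‖∑ j, u j‖ ^ 2 ≤ (∑ j, ‖u j‖) ^ 2 := by gcongr; exact norm_sum_le _ _
    _ ≤ _ := by simpa using sq_sum_le_card_mul_sum_sq (s := Finset.univ) (f := fun j => ‖u j‖)

/-- The operator `γ - k ∑ σ_α` on functions on an orbit has nonnegative real part. -/
lemma orbit_accretive {n : ℕ} {k : ℂ} (hγ : 0 ≤ (gam n k).re) (u v : Fin n → ℂ) :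
    0 ≤ (∑ j, (conj (u j) * (gam n k * u j - k * ∑ i, v i) +
      conj (v j) * (gam n k * v j - k * ∑ i, u i))).re := by
  rcases Nat.eq_zero_or_pos n with rfl | hn
  · simp
  have hk : 0 ≤ k.re := by
    have : (gam n k).re = n * k.re := by simp [gam]
    rw [this] at hγ
    exact nonneg_of_mul_nonneg_right hγ (by exact_mod_cast hn)
  set U := ∑ i, u i with hU
  set V := ∑ i, v i with hV
  -- The cross terms add up to a real number times `k`, and `γ = n k`. The real part is thus `Re k`
  -- times a real quadratic form, which is nonnegative by Cauchy-Schwarz.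
  have e : ∑ j, (conj (u j) * (gam n k * u j - k * V) + conj (v j) * (gam n k * v j - k * U)) =
      gam n k * ((∑ j, ‖u j‖ ^ 2 + ∑ j, ‖v j‖ ^ 2 : ℝ) : ℂ) -
        k * ((2 * (conj U * V).re : ℝ) : ℂ) := by
    have h1 : ((2 * (conj U * V).re : ℝ) : ℂ) = conj U * V + conj V * U := by
      push_cast
      rw [Complex.re_eq_add_conj]
      simp only [map_mul, Complex.conj_conj]
      ring
    have h2 : conj U = ∑ j, conj (u j) := map_sum _ _ _
    have h3 : conj V = ∑ j, conj (v j) := map_sum _ _ _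
    rw [h1, h2, h3]
    clear_value U V
    push_cast
    simp_rw [← Complex.conj_mul']
    rw [mul_add, mul_add, Finset.mul_sum, Finset.mul_sum, Finset.sum_mul, Finset.sum_mul,
      Finset.mul_sum, Finset.mul_sum, ← Finset.sum_add_distrib, ← Finset.sum_add_distrib,
      ← Finset.sum_sub_distrib]
    exact Finset.sum_congr rfl fun j _ => by ring
  rw [e, Complex.sub_re, Complex.re_mul_ofReal, Complex.re_mul_ofReal]
  have h4 : 2 * (conj U * V).re ≤ n * (∑ j, ‖u j‖ ^ 2 + ∑ j, ‖v j‖ ^ 2) := by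
    have := norm_sum_sq_le u
    have := norm_sum_sq_le v
    have h5 : (conj U * V).re ≤ ‖U‖ * ‖V‖ := by
      refine (Complex.re_le_norm _).trans ?_
      rw [norm_mul, RCLike.norm_conj]
    nlinarith [sq_nonneg (‖U‖ - ‖V‖)]
  have h6 : (gam n k).re = n * k.re := by simp [gam]
  rw [h6]
  nlinarith

/-- The operator `m + γ - k ∑ σ_α` on functions on an orbit is bounded below by `m`. -/
lemma orbit_bound {n : ℕ} {k : ℂ} (hγ : 0 ≤ (gam n k).re) (u v p q : Fin n → ℂ) {m : ℝ}
    (hm : 0 ≤ m)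
    (hu : ∀ j, (m + gam n k) * u j - k * ∑ i, v i = p j)
    (hv : ∀ j, (m + gam n k) * v j - k * ∑ i, u i = q j) :
    m ^ 2 * ∑ j, (‖u j‖ ^ 2 + ‖v j‖ ^ 2) ≤ ∑ j, (‖p j‖ ^ 2 + ‖q j‖ ^ 2) := by
  have h := orbit_accretive hγ u v
  have e : ∑ j, (conj (u j) * (gam n k * u j - k * ∑ i, v i) +
      conj (v j) * (gam n k * v j - k * ∑ i, u i)) =
      ∑ j, (conj (u j) * p j + conj (v j) * q j) -
        ((m * ∑ j, (‖u j‖ ^ 2 + ‖v j‖ ^ 2) : ℝ) : ℂ) := by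
    push_cast
    simp_rw [← Complex.conj_mul']
    conv_rhs => rw [Finset.mul_sum, ← Finset.sum_sub_distrib]
    refine Finset.sum_congr rfl fun j _ => ?_
    rw [← hu, ← hv]
    ring
  rw [e, Complex.sub_re, Complex.ofReal_re, Complex.re_sum] at h
  -- The inequality `2 m |u| |p| ≤ m² |u|² + |p|²` absorbs half of the lower bound `2 m²` into the
  -- left-hand side.
  have h2 : ∀ j, 2 * m * (conj (u j) * p j + conj (v j) * q j).re ≤
      m ^ 2 * (‖u j‖ ^ 2 + ‖v j‖ ^ 2) + (‖p j‖ ^ 2 + ‖q j‖ ^ 2) := by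
    intro j
    have h3 : ∀ a b : ℂ, (conj a * b).re ≤ ‖a‖ * ‖b‖ := fun a b => by
      refine (Complex.re_le_norm _).trans ?_
      rw [norm_mul, RCLike.norm_conj]
    have := mul_le_mul_of_nonneg_left (h3 (u j) (p j)) hm
    have := mul_le_mul_of_nonneg_left (h3 (v j) (q j)) hm
    rw [Complex.add_re]
    nlinarith [sq_nonneg (m * ‖u j‖ - ‖p j‖), sq_nonneg (m * ‖v j‖ - ‖q j‖)]
  have h4 := Finset.sum_le_sum fun j (_ : j ∈ Finset.univ) => h2 j
  rw [Finset.sum_add_distrib, ← Finset.mul_sum, ← Finset.mul_sum] at h4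
  nlinarith

/-- The difference of the two pairs solves the system with zero right-hand side, so `orbit_bound`
with `m > 0` kills it. This is how two families on one orbit satisfying the same radial recursion
are identified. -/
lemma orbit_unique {n : ℕ} {k : ℂ} (hγ : 0 ≤ (gam n k).re) (u v u' v' : Fin n → ℂ) {m : ℝ}
    (hm : 0 < m)
    (hu : ∀ j, (m + gam n k) * u j - k * ∑ i, v i = (m + gam n k) * u' j - k * ∑ i, v' i)
    (hv : ∀ j, (m + gam n k) * v j - k * ∑ i, u i = (m + gam n k) * v' j - k * ∑ i, u' i) :
    u = u' ∧ v = v' := by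
  have h := orbit_bound hγ (u - u') (v - v') 0 0 hm.le
    (fun j => by
      simp only [Pi.sub_apply, Finset.sum_sub_distrib, Pi.zero_apply]
      linear_combination hu j)
    (fun j => by
      simp only [Pi.sub_apply, Finset.sum_sub_distrib, Pi.zero_apply]
      linear_combination hv j)
  have h0 : ∑ j, (‖(u - u') j‖ ^ 2 + ‖(v - v') j‖ ^ 2) = 0 := by
    refine le_antisymm ?_ (by positivity)
    refine nonpos_of_mul_nonpos_right (a := m ^ 2) ?_ (by positivity)
    simpa using h
  rw [Finset.sum_eq_zero_iff_of_nonneg (fun j _ => by positivity)] at h0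
  constructor <;> funext j <;> rw [← sub_eq_zero, ← norm_eq_zero, ← sq_eq_zero_iff] <;>
    have := h0 j (Finset.mem_univ j) <;> simp only [Pi.sub_apply] at this <;>
    nlinarith [sq_nonneg ‖u j - u' j‖, sq_nonneg ‖v j - v' j‖]

/-! ### Sums of reflections -/

section Resolvent

variable {A : Type*} [Ring A] [Algebra ℂ A]

/-- For fixed `i` and `j` the index `i - j + l` runs once through all reflections as `l` varies;
there are `n²` pairs `(i, j)`. -/
lemma sum_pow_three {n : ℕ} [NeZero n] (T : Fin n → A)
    (hT : ∀ i j l, T i * T j * T l = T (i - j + l)) :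
    (∑ j, T j) * (∑ j, T j) * (∑ j, T j) = (n ^ 2 : ℂ) • ∑ j, T j := by
  have h : ∀ i j, ∑ l, T i * T j * T l = ∑ l, T l := fun i j => by
    simp_rw [hT]
    exact Equiv.sum_comp (Equiv.addLeft (i - j)) T
  rw [Finset.sum_mul_sum, Finset.sum_mul]
  simp_rw [Finset.sum_mul, Finset.mul_sum, h]
  simp only [Finset.sum_const, Finset.card_univ, Fintype.card_fin, smul_smul]
  rw [← Nat.cast_smul_eq_nsmul ℂ]
  push_cast
  rw [sq]

/-- The inverse of `m + γ - k S` for an operator `S` with `S ^ 3 = n ^ 2 S`. -/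
def resolvent (n : ℕ) (k m : ℂ) (S : A) : A :=
  (m + gam n k)⁻¹ • (1 : A) + (k / (m * (m + 2 * gam n k))) • S +
    (k ^ 2 / ((m + gam n k) * (m * (m + 2 * gam n k)))) • (S * S)

variable {n : ℕ} {k m : ℂ} {S : A}

/-- The relation `S³ = n² S` allows only the eigenvalues `0`, `n`, `-n` for `S`, hence `m + γ`, `m`,
`m + 2γ` for `m + γ - k S`. These are the three numbers assumed nonzero. -/
lemma resolvent_mul (hS : S * S * S = (n ^ 2 : ℂ) • S) (h0 : m ≠ 0) (h1 : m + gam n k ≠ 0)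
    (h2 : m + 2 * gam n k ≠ 0) :
    resolvent n k m S * ((m + gam n k) • (1 : A) - k • S) = 1 := by
  have e : resolvent n k m S * ((m + gam n k) • (1 : A) - k • S) =
      ((m + gam n k) * (m + gam n k)⁻¹) • (1 : A) +
      ((m + gam n k) * (k / (m * (m + 2 * gam n k))) - k * (m + gam n k)⁻¹) • S +
      ((m + gam n k) * (k ^ 2 / ((m + gam n k) * (m * (m + 2 * gam n k)))) -
        k * (k / (m * (m + 2 * gam n k)))) • (S * S) -
      (k * (k ^ 2 / ((m + gam n k) * (m * (m + 2 * gam n k))))) • (S * S * S) := by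
    rw [resolvent]
    simp only [mul_sub, add_mul, mul_smul_comm, smul_mul_assoc, one_mul, mul_one]
    module
  have e1 : (m + gam n k) * (k ^ 2 / ((m + gam n k) * (m * (m + 2 * gam n k)))) -
        k * (k / (m * (m + 2 * gam n k))) = 0 := by
    field_simp
    ring
  have e2 : (m + gam n k) * (k / (m * (m + 2 * gam n k))) - k * (m + gam n k)⁻¹ -
      (k * (k ^ 2 / ((m + gam n k) * (m * (m + 2 * gam n k))))) * n ^ 2 = 0 := by
    have e3 : gam n k ^ 2 - (n * k) ^ 2 = 0 := by rw [gam]; ring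
    have e4 : (m + gam n k) * (k / (m * (m + 2 * gam n k))) - k * (m + gam n k)⁻¹ -
      (k * (k ^ 2 / ((m + gam n k) * (m * (m + 2 * gam n k))))) * n ^ 2 =
      k * (gam n k ^ 2 - (n * k) ^ 2) / ((m + gam n k) * (m * (m + 2 * gam n k))) := by
      obtain ⟨D, hD⟩ : ∃ D, D = m + 2 * gam n k := ⟨_, rfl⟩
      rw [← hD] at h2 ⊢
      field_simp
      rw [hD]
      ring
    rw [e4, e3, mul_zero, zero_div]
  rw [e, hS, e1, mul_inv_cancel₀ h1, one_smul, zero_smul, add_zero, smul_smul, add_sub_assoc,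
    ← sub_smul, e2, zero_smul, add_zero]

lemma commute_resolvent : Commute (resolvent n k m S) ((m + gam n k) • (1 : A) - k • S) := by
  have h : Commute (resolvent n k m S) S := by
    refine ((((Commute.one_left S).smul_left _).add_left ?_).add_left ?_)
    · exact (Commute.refl S).smul_left _
    · exact (((Commute.refl S).mul_left (Commute.refl S)).smul_left _)
  exact ((Commute.one_right _).smul_right _).sub_right (h.smul_right _)

lemma mul_resolvent (hS : S * S * S = (n ^ 2 : ℂ) • S) (h0 : m ≠ 0) (h1 : m + gam n k ≠ 0)
    (h2 : m + 2 * gam n k ≠ 0) :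
    ((m + gam n k) • (1 : A) - k • S) * resolvent n k m S = 1 := by
  rw [← commute_resolvent.eq, resolvent_mul hS h0 h1 h2]

end Resolvent

/-! ### Dunkl operators on polynomials in complex coordinates -/

open MvPolynomial

/-- Polynomials in two variables, thought of as `x` and `conj x`. -/
abbrev Poly := MvPolynomial (Fin 2) ℂ

/-- The action on polynomials of the reflection `x ↦ omega n j * conj x`. -/
def tau (n : ℕ) (j : Fin n) : Poly →ₐ[ℂ] Poly :=
  aeval ![C (omega n j) * X 1, C (omega n j)⁻¹ * X 0]

@[simp] lemma tau_X_zero (n : ℕ) (j : Fin n) : tau n j (X 0) = C (omega n j) * X 1 := by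
  simp [tau]

@[simp] lemma tau_X_one (n : ℕ) (j : Fin n) : tau n j (X 1) = C (omega n j)⁻¹ * X 0 := by
  simp [tau]

@[simp] lemma tau_C (n : ℕ) (j : Fin n) (c : ℂ) : tau n j (C c) = C c := by
  simp [tau]

lemma tau_mul_tau_mul_tau (n : ℕ) [NeZero n] (i j l : Fin n) :
    ((tau n i).comp (tau n j)).comp (tau n l) = tau n (i - j + l) := by
  have hi := omega_ne_zero n i
  have hj := omega_ne_zero n j
  have hl := omega_ne_zero n l
  refine MvPolynomial.algHom_ext fun s => ?_
  fin_cases s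
  · simp only [Fin.zero_eta, AlgHom.comp_apply, tau_X_zero, map_mul, tau_C, tau_X_one, omega_add,
      omega_sub]
    ring
  · simp only [Fin.mk_one, AlgHom.comp_apply, tau_X_zero, map_mul, tau_C, tau_X_one, omega_add,
      omega_sub, mul_inv, inv_inv]
    ring

lemma tau_tau_tau (n : ℕ) [NeZero n] (i j l : Fin n) (p : Poly) :
    tau n i (tau n j (tau n l p)) = tau n (i - j + l) p := by
  rw [← tau_mul_tau_mul_tau]; rfl

lemma tau_tau (n : ℕ) (i : Fin n) (p : Poly) : tau n i (tau n i p) = p := by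
  have hi := omega_ne_zero n i
  have : (tau n i).comp (tau n i) = AlgHom.id ℂ Poly := by
    refine MvPolynomial.algHom_ext fun s => ?_
    fin_cases s
    · simp only [Fin.zero_eta, AlgHom.comp_apply, tau_X_zero, map_mul, tau_C, tau_X_one,
        AlgHom.id_apply, ← mul_assoc, ← C_mul, mul_inv_cancel₀ hi, C_1, one_mul]
    · simp only [Fin.mk_one, AlgHom.comp_apply, tau_X_zero, map_mul, tau_C, tau_X_one,
        AlgHom.id_apply, ← mul_assoc, ← C_mul, inv_mul_cancel₀ hi, C_1, one_mul]
  exact DFunLike.congr_fun this p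

lemma eval_tau (n : ℕ) (j : Fin n) (a b : ℂ) (p : Poly) :
    eval ![a, b] (tau n j p) = eval ![omega n j * b, (omega n j)⁻¹ * a] p := by
  have : (aeval ![a, b]).comp (tau n j) =
      (aeval ![omega n j * b, (omega n j)⁻¹ * a] : Poly →ₐ[ℂ] ℂ) := by
    refine MvPolynomial.algHom_ext fun s => ?_
    fin_cases s <;> simp
  simpa [aeval_eq_eval] using DFunLike.congr_fun this p

lemma isHomogeneous_tau {n : ℕ} (j : Fin n) {p : Poly} {m : ℕ} (hp : p.IsHomogeneous m) :
    (tau n j p).IsHomogeneous m := by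
  have := hp.aeval (n := 1) (![C (omega n j) * X 1, C (omega n j)⁻¹ * X 0] : Fin 2 → Poly) (fun s => by
    fin_cases s
    · exact isHomogeneous_C_mul_X _ _
    · exact isHomogeneous_C_mul_X _ _)
  rw [one_mul] at this
  exact this

/-! ### Divided differences along the mirrors. -/

/-- A linear form vanishing on the line fixed by `x ↦ omega n j * conj x`. -/
def rootForm (n : ℕ) (j : Fin n) : Poly := X 0 - C (omega n j) * X 1

lemma rootForm_ne_zero (n : ℕ) (j : Fin n) : rootForm n j ≠ 0 := by
  intro h
  have := congrArg (eval ![1, 0]) h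
  simp [rootForm] at this

/-- The map `p ↦ p - τ p` is a twisted derivation, so divisibility needs checking only on the two
variables. -/
lemma rootForm_dvd (n : ℕ) (j : Fin n) (p : Poly) : rootForm n j ∣ p - tau n j p := by
  have hj := omega_ne_zero n j
  induction p using MvPolynomial.induction_on with
  | C c => simp
  | add p q hp hq =>
    rw [map_add, add_sub_add_comm]
    exact dvd_add hp hq
  | mul_X p i hp =>
    have hX : rootForm n j ∣ X i - tau n j (X i) := by
      fin_cases i
      · simp [rootForm]
      · refine ⟨-C (omega n j)⁻¹, ?_⟩
        simp only [Fin.mk_one, tau_X_one, rootForm]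
        have : C (omega n j) * C (omega n j)⁻¹ = (1 : Poly) := by
          rw [← C_mul, mul_inv_cancel₀ hj, C_1]
        linear_combination (-X 1 : Poly) * this
    have : p * X i - tau n j (p * X i) =
        (p - tau n j p) * X i + tau n j p * (X i - tau n j (X i)) := by
      rw [map_mul]; ring
    rw [this]
    exact dvd_add (hp.mul_right _) (hX.mul_left _)

/-- The divided difference `(p - τ p) / (X₀ - ω X₁)`. -/
def divDiff (n : ℕ) (j : Fin n) : Poly →ₗ[ℂ] Poly where
  toFun p := (rootForm_dvd n j p).choose
  map_add' p q := by
    refine mul_left_cancel₀ (rootForm_ne_zero n j) ?_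
    rw [mul_add, ← (rootForm_dvd n j _).choose_spec, ← (rootForm_dvd n j _).choose_spec,
      ← (rootForm_dvd n j _).choose_spec, map_add, add_sub_add_comm]
  map_smul' c p := by
    refine mul_left_cancel₀ (rootForm_ne_zero n j) ?_
    rw [RingHom.id_apply, mul_smul_comm, ← (rootForm_dvd n j _).choose_spec,
      ← (rootForm_dvd n j _).choose_spec, map_smul, smul_sub]

lemma rootForm_mul_divDiff (n : ℕ) (j : Fin n) (p : Poly) :
    rootForm n j * divDiff n j p = p - tau n j p :=
  (rootForm_dvd n j p).choose_spec.symm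

lemma divDiff_eq {n : ℕ} {j : Fin n} {p q : Poly} (h : rootForm n j * q = p - tau n j p) :
    divDiff n j p = q :=
  mul_left_cancel₀ (rootForm_ne_zero n j) (by rw [h, rootForm_mul_divDiff])

lemma divDiff_X_zero_mul (n : ℕ) (j : Fin n) (q : Poly) :
    divDiff n j (X 0 * q) = X 0 * divDiff n j q + tau n j q := by
  refine divDiff_eq ?_
  rw [mul_add, mul_left_comm, rootForm_mul_divDiff, map_mul, tau_X_zero, rootForm]
  ring

lemma C_mul_C_inv {c : ℂ} (hc : c ≠ 0) : (C c * C c⁻¹ : Poly) = 1 := by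
  rw [← C_mul, mul_inv_cancel₀ hc, C_1]

lemma divDiff_X_one_mul (n : ℕ) (j : Fin n) (q : Poly) :
    divDiff n j (X 1 * q) = X 1 * divDiff n j q - C (omega n j)⁻¹ * tau n j q := by
  refine divDiff_eq ?_
  rw [mul_sub, mul_left_comm, rootForm_mul_divDiff, map_mul, tau_X_one, rootForm]
  linear_combination (X 1 * tau n j q) * C_mul_C_inv (omega_ne_zero n j)

lemma divDiff_C (n : ℕ) (j : Fin n) (c : ℂ) : divDiff n j (C c) = 0 :=
  divDiff_eq (by simp)

/-- Conjugating the reflection `j` by the reflection `l` gives the reflection `l - j + l`. The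
scalar is the ratio of `τ_l` of one root form to the other. -/
lemma tau_divDiff (n : ℕ) [NeZero n] (l j : Fin n) (p : Poly) :
    divDiff n (l - j + l) (tau n l p) =
      -(C (omega n j) * C (omega n l)⁻¹ * tau n l (divDiff n j p)) := by
  refine divDiff_eq ?_
  have h := congrArg (tau n l) (rootForm_mul_divDiff n j p)
  have h2 : tau n l (tau n j p) = tau n (l - j + l) (tau n l p) := by
    rw [← tau_tau_tau, tau_tau]
  rw [map_sub, h2] at h
  rw [← h, map_mul]
  have hl := C_mul_C_inv (omega_ne_zero n l)
  have hj := C_mul_C_inv (omega_ne_zero n j)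
  simp only [rootForm, map_sub, map_mul, tau_X_zero, tau_X_one, tau_C, omega_add, omega_sub]
  linear_combination (tau n l (divDiff n j p) * X 1 * C (omega n l)) *
    ( C (omega n l) * C (omega n l)⁻¹ * hj + hl)

/-- The sum of the reflections. -/
def reflOp (n : ℕ) : Poly →ₗ[ℂ] Poly := ∑ j, (tau n j).toLinearMap

lemma reflOp_apply (n : ℕ) (p : Poly) : reflOp n p = ∑ j, tau n j p := by
  simp [reflOp]

lemma reflOp_pow_three (n : ℕ) [NeZero n] :
    reflOp n * reflOp n * reflOp n = (n ^ 2 : ℂ) • reflOp n :=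
  sum_pow_three (A := Module.End ℂ Poly) (fun j => (tau n j).toLinearMap) fun i j l =>
    LinearMap.ext fun p => tau_tau_tau n i j l p

/-! ### Dunkl operators in complex coordinates: radial identity, commutation with multiplication,
equivariance. -/

/-- The Dunkl operator in the direction of the first complex coordinate. -/
def dunkl₀ (n : ℕ) (k : ℂ) (p : Poly) : Poly :=
  pderiv 0 p + k • ∑ j, divDiff n j p

/-- The Dunkl operator in the direction of the second complex coordinate. -/
def dunkl₁ (n : ℕ) (k : ℂ) (p : Poly) : Poly :=
  pderiv 1 p - k • ∑ j, C (omega n j) * divDiff n j p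

/-- Euler's identity gives `m`. In the difference part the variables recombine to the root forms,
which cancel the denominators and leave `∑ (p - τ p) = n p - S p`. -/
lemma X_mul_dunkl (n : ℕ) (k : ℂ) {p : Poly} {m : ℕ} (hp : p.IsHomogeneous m) :
    X 0 * dunkl₀ n k p + X 1 * dunkl₁ n k p = ((m : ℂ) + gam n k) • p - k • reflOp n p := by
  have h1 := hp.sum_X_mul_pderiv
  rw [Fin.sum_univ_two, ← Nat.cast_smul_eq_nsmul ℂ] at h1
  have h2 : ∑ j : Fin n, rootForm n j * divDiff n j p = (n : ℂ) • p - reflOp n p := by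
    simp_rw [rootForm_mul_divDiff]
    rw [Finset.sum_sub_distrib, reflOp_apply, Finset.sum_const, Finset.card_univ,
      Fintype.card_fin, Nat.cast_smul_eq_nsmul]
  have h3 : ∑ j : Fin n, rootForm n j * divDiff n j p =
      X 0 * ∑ j, divDiff n j p - X 1 * ∑ j, C (omega n j) * divDiff n j p := by
    rw [Finset.mul_sum, Finset.mul_sum, ← Finset.sum_sub_distrib]
    refine Finset.sum_congr rfl fun j _ => ?_
    rw [rootForm]; ring
  rw [h3] at h2
  have h4 : k • (X 0 * ∑ j, divDiff n j p - X 1 * ∑ j, C (omega n j) * divDiff n j p) =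
    gam n k • p - k • reflOp n p := by
    rw [h2, smul_sub, smul_smul, gam, mul_comm]
  rw [dunkl₀, dunkl₁, mul_add, mul_sub, mul_smul_comm, mul_smul_comm, add_smul, ← h1]
  rw [smul_sub] at h4
  linear_combination h4

lemma dunkl₀_X_zero_mul (n : ℕ) (k : ℂ) (q : Poly) :
    dunkl₀ n k (X 0 * q) = X 0 * dunkl₀ n k q + q + k • reflOp n q := by
  simp only [dunkl₀, divDiff_X_zero_mul, Finset.sum_add_distrib, ← Finset.mul_sum, reflOp_apply,
    Derivation.leibniz, pderiv_X_self, smul_eq_mul, smul_add, mul_add, mul_smul_comm]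
  ring

lemma dunkl₀_X_one_mul (n : ℕ) (k : ℂ) (q : Poly) :
    dunkl₀ n k (X 1 * q) =
      X 1 * dunkl₀ n k q - k • ∑ j, C (omega n j)⁻¹ * tau n j q := by
  simp only [dunkl₀, divDiff_X_one_mul, Finset.sum_sub_distrib, ← Finset.mul_sum,
    Derivation.leibniz, smul_eq_mul, smul_sub, mul_add, mul_smul_comm,
    pderiv_X_of_ne (R := ℂ) (show (1 : Fin 2) ≠ 0 by decide)]
  ring

lemma dunkl₁_X_zero_mul (n : ℕ) (k : ℂ) (q : Poly) :
    dunkl₁ n k (X 0 * q) = X 0 * dunkl₁ n k q - k • ∑ j, C (omega n j) * tau n j q := by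
  have h : ∀ j, C (omega n j) * divDiff n j (X 0 * q) =
      X 0 * (C (omega n j) * divDiff n j q) + C (omega n j) * tau n j q := fun j => by
    rw [divDiff_X_zero_mul]
    ring
  simp only [dunkl₁, h, Finset.sum_add_distrib, ← Finset.mul_sum, Derivation.leibniz,
    smul_eq_mul, smul_add, mul_sub, mul_smul_comm,
    pderiv_X_of_ne (R := ℂ) (show (0 : Fin 2) ≠ 1 by decide)]
  ring

lemma dunkl₁_X_one_mul (n : ℕ) (k : ℂ) (q : Poly) :
    dunkl₁ n k (X 1 * q) = X 1 * dunkl₁ n k q + q + k • reflOp n q := by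
  have h : ∀ j, C (omega n j) * divDiff n j (X 1 * q) =
      X 1 * (C (omega n j) * divDiff n j q) - tau n j q := fun j => by
    rw [divDiff_X_one_mul]
    linear_combination (-tau n j q) * C_mul_C_inv (omega_ne_zero n j)
  simp only [dunkl₁, h, Finset.sum_sub_distrib, ← Finset.mul_sum, reflOp_apply,
    Derivation.leibniz, pderiv_X_self, smul_eq_mul, smul_sub, mul_sub, mul_smul_comm]
  ring

lemma pderiv_tau (n : ℕ) (l : Fin n) (p : Poly) :
    pderiv 0 (tau n l p) = C (omega n l)⁻¹ * tau n l (pderiv 1 p) ∧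
      pderiv 1 (tau n l p) = C (omega n l) * tau n l (pderiv 0 p) := by
  induction p using MvPolynomial.induction_on with
  | C c => simp
  | add p q hp hq => simp only [map_add, hp, hq, mul_add, and_self]
  | mul_X p i hp =>
    fin_cases i
    · simp [hp, pderiv_X_of_ne (R := ℂ) (show (0 : Fin 2) ≠ 1 by decide),
        pderiv_X_of_ne (R := ℂ) (show (1 : Fin 2) ≠ 0 by decide), Derivation.leibniz]
      constructor <;> ring
    · simp [hp, pderiv_X_of_ne (R := ℂ) (show (0 : Fin 2) ≠ 1 by decide),
        pderiv_X_of_ne (R := ℂ) (show (1 : Fin 2) ≠ 0 by decide), Derivation.leibniz]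
      constructor <;> ring

lemma sum_reindex {n : ℕ} [NeZero n] {M : Type*} [AddCommMonoid M] (l : Fin n) (f : Fin n → M) :
    ∑ j, f (l - j + l) = ∑ j, f j :=
  Equiv.sum_comp ((Equiv.subLeft l).trans (Equiv.addRight l)) f

/-- A reflection exchanges the two complex directions, up to the unimodular factor `ω`. As a result,
reflections of vector fields appear when a Dunkl operator passes `S`. -/
lemma dunkl₀_tau (n : ℕ) [NeZero n] (k : ℂ) (l : Fin n) (p : Poly) :
    dunkl₀ n k (tau n l p) = C (omega n l)⁻¹ * tau n l (dunkl₁ n k p) := by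
  rw [dunkl₀, ← sum_reindex l, (pderiv_tau n l p).1, dunkl₁]
  simp only [tau_divDiff, map_sub, map_smul, map_sum, map_mul, tau_C, mul_sub, mul_smul_comm,
    Finset.mul_sum, Finset.sum_neg_distrib, smul_neg, ← sub_eq_add_neg]
  congr 2
  exact Finset.sum_congr rfl fun j _ => by ring

lemma dunkl₁_tau (n : ℕ) [NeZero n] (k : ℂ) (l : Fin n) (p : Poly) :
    dunkl₁ n k (tau n l p) = C (omega n l) * tau n l (dunkl₀ n k p) := by
  have h := congrArg (tau n l) (dunkl₀_tau n k l (tau n l p))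
  rw [tau_tau, map_mul, tau_tau, tau_C] at h
  rw [h]
  linear_combination (-dunkl₁ n k (tau n l p)) * C_mul_C_inv (omega_ne_zero n l)

/-! ### The intertwining operator in complex coordinates -/

lemma gam_add_ne_zero {n : ℕ} {k : ℂ} (hγ : 0 < (gam n k).re) {m : ℝ} (hm : 0 ≤ m) :
    (m : ℂ) + gam n k ≠ 0 := fun h => by
  have := congrArg Complex.re h
  simp only [Complex.add_re, Complex.ofReal_re, Complex.zero_re] at this
  linarith

lemma two_gam_add_ne_zero {n : ℕ} {k : ℂ} (hγ : 0 < (gam n k).re) {m : ℝ} (hm : 0 ≤ m) :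
    (m : ℂ) + 2 * gam n k ≠ 0 := fun h => by
  have := congrArg Complex.re h
  simp only [Complex.add_re, Complex.ofReal_re, Complex.mul_re, Complex.re_ofNat,
    Complex.im_ofNat, Complex.zero_re] at this
  linarith

/-- The operator `(d₀, d₁) ↦ (∑ ω⁻¹ τ d₁, ∑ ω τ d₀)` on vector fields. -/
def fieldRefl (n : ℕ) (j : Fin n) : Module.End ℂ (Poly × Poly) :=
  LinearMap.prod ((omega n j)⁻¹ • (tau n j).toLinearMap ∘ₗ LinearMap.snd ℂ Poly Poly)
    (omega n j • (tau n j).toLinearMap ∘ₗ LinearMap.fst ℂ Poly Poly)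

lemma fieldRefl_apply (n : ℕ) (j : Fin n) (p : Poly × Poly) :
    fieldRefl n j p = ((omega n j)⁻¹ • tau n j p.2, omega n j • tau n j p.1) := rfl

lemma fieldRefl_mul (n : ℕ) [NeZero n] (i j l : Fin n) :
    fieldRefl n i * fieldRefl n j * fieldRefl n l = fieldRefl n (i - j + l) := by
  refine LinearMap.ext fun p => ?_
  simp only [fieldRefl_apply, Module.End.mul_apply, map_smul, smul_smul, tau_tau_tau, omega_add,
    omega_sub, mul_inv, inv_inv, mul_assoc]

/-- The reflections acting on vector fields again satisfy the three-term product law, so the same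
resolvent inverts `m + γ - k S` on pairs of polynomials. -/
lemma field_unique {n : ℕ} [NeZero n] {k : ℂ} (hγ : 0 < (gam n k).re) {m : ℕ} (hm : 0 < m)
    {u₀ u₁ q₀ q₁ : Poly}
    (h₀ : ((m : ℂ) + gam n k) • u₀ - k • ∑ j, C (omega n j)⁻¹ * tau n j u₁ =
      ((m : ℂ) + gam n k) • q₀ - k • ∑ j, C (omega n j)⁻¹ * tau n j q₁)
    (h₁ : ((m : ℂ) + gam n k) • u₁ - k • ∑ j, C (omega n j) * tau n j u₀ =
      ((m : ℂ) + gam n k) • q₁ - k • ∑ j, C (omega n j) * tau n j q₀) :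
    u₀ = q₀ ∧ u₁ = q₁ := by
  set S : Module.End ℂ (Poly × Poly) := ∑ j, fieldRefl n j with hS
  have hinv := resolvent_mul (n := n) (k := k) (m := m) (S := S)
    (sum_pow_three _ (fieldRefl_mul n)) (Nat.cast_ne_zero.2 hm.ne')
    (by simpa using gam_add_ne_zero hγ (m := m) (by positivity))
    (by simpa using two_gam_add_ne_zero hγ (m := m) (by positivity))
  have happ : ∀ p : Poly × Poly,
      (((m : ℂ) + gam n k) • (1 : Module.End ℂ (Poly × Poly)) - k • S) p =
      (((m : ℂ) + gam n k) • p.1 - k • ∑ j, C (omega n j)⁻¹ * tau n j p.2,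
        ((m : ℂ) + gam n k) • p.2 - k • ∑ j, C (omega n j) * tau n j p.1) := by
    intro p
    refine Prod.ext ?_ ?_ <;>
    simp [hS, fieldRefl_apply, LinearMap.sum_apply, Prod.fst_sum, Prod.snd_sum, smul_eq_C_mul]
  have h : (u₀, u₁) = (q₀, q₁) := by
    have e := congrArg (resolvent (A := Module.End ℂ (Poly × Poly)) n k m S)
      (((happ (u₀, u₁)).trans (Prod.ext h₀ h₁)).trans (happ (q₀, q₁)).symm)
    rwa [← Module.End.mul_apply, ← Module.End.mul_apply, hinv] at e
  exact ⟨congrArg Prod.fst h, congrArg Prod.snd h⟩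

/-- The intertwining operator on homogeneous polynomials of degree `m`. -/
def interDeg (n : ℕ) (k : ℂ) : ℕ → (Poly →ₗ[ℂ] Poly)
  | 0 => homogeneousComponent 0
  | m + 1 =>
    -- The unique solution of the radial equation that the intertwining relation forces in degree `m
    -- + 1`.
    (resolvent (A := Module.End ℂ Poly) n k ((m + 1 : ℕ) : ℂ) (reflOp n)) *
      (LinearMap.mulLeft ℂ (X 0) ∘ₗ interDeg n k m ∘ₗ (pderiv (R := ℂ) (0 : Fin 2)).toLinearMap +
       LinearMap.mulLeft ℂ (X 1) ∘ₗ interDeg n k m ∘ₗ (pderiv (R := ℂ) (1 : Fin 2)).toLinearMap)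

lemma isHomogeneous_reflOp {n m : ℕ} {p : Poly} (hp : p.IsHomogeneous m) :
    (reflOp n p).IsHomogeneous m := by
  rw [reflOp_apply]
  exact IsHomogeneous.sum _ _ _ fun j _ => isHomogeneous_tau j hp

lemma dunkl₀_add (n : ℕ) (k : ℂ) (p q : Poly) :
    dunkl₀ n k (p + q) = dunkl₀ n k p + dunkl₀ n k q := by
  simp only [dunkl₀, map_add, Finset.sum_add_distrib, smul_add]
  abel

lemma dunkl₁_add (n : ℕ) (k : ℂ) (p q : Poly) :
    dunkl₁ n k (p + q) = dunkl₁ n k p + dunkl₁ n k q := by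
  simp only [dunkl₁, map_add, mul_add, Finset.sum_add_distrib, smul_add]
  abel

lemma dunkl₀_smul (n : ℕ) (k c : ℂ) (p : Poly) :
    dunkl₀ n k (c • p) = c • dunkl₀ n k p := by
  simp only [dunkl₀, Derivation.map_smul, map_smul, ← Finset.smul_sum, smul_add, smul_comm k c]

lemma dunkl₁_smul (n : ℕ) (k c : ℂ) (p : Poly) :
    dunkl₁ n k (c • p) = c • dunkl₁ n k p := by
  simp only [dunkl₁, Derivation.map_smul, map_smul, mul_smul_comm, ← Finset.smul_sum, smul_sub, smul_comm k c]

lemma dunkl₀_zero (n : ℕ) (k : ℂ) : dunkl₀ n k 0 = 0 := by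
  simpa using dunkl₀_smul n k 0 0

lemma dunkl₁_zero (n : ℕ) (k : ℂ) : dunkl₁ n k 0 = 0 := by
  simpa using dunkl₁_smul n k 0 0

lemma dunkl₀_sub (n : ℕ) (k : ℂ) (p q : Poly) :
    dunkl₀ n k (p - q) = dunkl₀ n k p - dunkl₀ n k q := by
  rw [eq_sub_iff_add_eq, ← dunkl₀_add, sub_add_cancel]

lemma dunkl₁_sub (n : ℕ) (k : ℂ) (p q : Poly) :
    dunkl₁ n k (p - q) = dunkl₁ n k p - dunkl₁ n k q := by
  rw [eq_sub_iff_add_eq, ← dunkl₁_add, sub_add_cancel]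

lemma dunkl₀_sum (n : ℕ) (k : ℂ) {ι : Type*} (s : Finset ι) (f : ι → Poly) :
    dunkl₀ n k (∑ i ∈ s, f i) = ∑ i ∈ s, dunkl₀ n k (f i) :=
  map_sum (AddMonoidHom.mk' (dunkl₀ n k) (dunkl₀_add n k)) f s

lemma dunkl₁_sum (n : ℕ) (k : ℂ) {ι : Type*} (s : Finset ι) (f : ι → Poly) :
    dunkl₁ n k (∑ i ∈ s, f i) = ∑ i ∈ s, dunkl₁ n k (f i) :=
  map_sum (AddMonoidHom.mk' (dunkl₁ n k) (dunkl₁_add n k)) f s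

lemma isHomogeneous_smul {m : ℕ} {p : Poly} (c : ℂ) (hp : p.IsHomogeneous m) :
    (c • p).IsHomogeneous m :=
  (homogeneousSubmodule (Fin 2) ℂ m).smul_mem c hp

lemma isHomogeneous_interDeg (n : ℕ) (k : ℂ) (m : ℕ) :
    ∀ {p : Poly}, p.IsHomogeneous m → (interDeg n k m p).IsHomogeneous m := by
  induction m with
  | zero => exact fun {p} hp => homogeneousComponent_isHomogeneous 0 p
  | succ m ih =>
    intro p hp
    have h : ∀ i : Fin 2, (X i * interDeg n k m (pderiv i p)).IsHomogeneous (m + 1) := fun i => by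
      rw [add_comm]
      exact (isHomogeneous_X _ _).mul (ih (by simpa using hp.pderiv (i := i)))
    have h2 := (h 0).add (h 1)
    have h3 := isHomogeneous_reflOp (n := n) h2
    have h4 := isHomogeneous_reflOp (n := n) h3
    exact ((isHomogeneous_smul _ h2).add (isHomogeneous_smul _ h3)).add (isHomogeneous_smul _ h4)

lemma interDeg_succ {n : ℕ} [NeZero n] {k : ℂ} (hγ : 0 < (gam n k).re) (m : ℕ) (p : Poly) :
    (((m + 1 : ℕ) : ℂ) + gam n k) • interDeg n k (m + 1) p - k • reflOp n (interDeg n k (m + 1) p) =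
      X 0 * interDeg n k m (pderiv 0 p) + X 1 * interDeg n k m (pderiv 1 p) := by
  have hinv := mul_resolvent (A := Module.End ℂ Poly) (n := n) (k := k) (m := ((m + 1 : ℕ) : ℂ))
    (reflOp_pow_three n) (Nat.cast_ne_zero.2 (Nat.succ_ne_zero m))
    (by simpa using gam_add_ne_zero hγ (m := (m + 1 : ℕ)) (by positivity))
    (by simpa using two_gam_add_ne_zero hγ (m := (m + 1 : ℕ)) (by positivity))
  have := LinearMap.congr_fun hinv
    (X 0 * interDeg n k m (pderiv 0 p) + X 1 * interDeg n k m (pderiv 1 p))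
  exact this

/-- The commutator of two derivations is a derivation, and this one vanishes on the variables. -/
lemma pderiv_pderiv_comm {σ R : Type*} [CommRing R] (i j : σ) (p : MvPolynomial σ R) :
    pderiv i (pderiv j p) = pderiv j (pderiv i p) := by
  have h : ⁅pderiv (R := R) i, pderiv (R := R) j⁆ = 0 := by
    refine MvPolynomial.derivation_ext fun l => ?_
    classical
    rw [Derivation.commutator_apply, pderiv_X, pderiv_X, Derivation.zero_apply]
    simp only [Pi.single_apply, apply_ite, pderiv_one, map_zero, ite_self, sub_self]
  have := DFunLike.congr_fun h p
  rwa [Derivation.commutator_apply, Derivation.zero_apply, sub_eq_zero] at this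

/-- Applying each Dunkl operator to the radial equation shows that `(T₀ V p, T₁ V p)` and `(V ∂₀ p,
V ∂₁ p)` solve the same system, which is injective by `field_unique`. -/
lemma dunkl_interDeg {n : ℕ} [NeZero n] {k : ℂ} (hγ : 0 < (gam n k).re) (m : ℕ) :
    ∀ p : Poly, p.IsHomogeneous (m + 1) →
      dunkl₀ n k (interDeg n k (m + 1) p) = interDeg n k m (pderiv 0 p) ∧
      dunkl₁ n k (interDeg n k (m + 1) p) = interDeg n k m (pderiv 1 p) := by
  -- The symmetry `T₀ V ∂₁ p = T₁ V ∂₀ p` lets the radial identity apply to `V ∂ᵢ p`. Its term in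
  -- `S` then cancels the one from commuting `Tᵢ` with `Xᵢ`.
  have step : ∀ (m : ℕ) (p : Poly), p.IsHomogeneous (m + 1) →
      dunkl₀ n k (interDeg n k m (pderiv 1 p)) = dunkl₁ n k (interDeg n k m (pderiv 0 p)) →
      dunkl₀ n k (interDeg n k (m + 1) p) = interDeg n k m (pderiv 0 p) ∧
      dunkl₁ n k (interDeg n k (m + 1) p) = interDeg n k m (pderiv 1 p) := by
    intro m p hp hsymm
    have hd : ∀ i : Fin 2, (interDeg n k m (pderiv i p)).IsHomogeneous m := fun i =>
      isHomogeneous_interDeg n k m (hp.pderiv (i := i))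
    have hs := interDeg_succ hγ m p
    have e₀ := X_mul_dunkl n k (hd 0)
    have e₁ := X_mul_dunkl n k (hd 1)
    refine field_unique hγ (Nat.succ_pos m) ?_ ?_
    · have h := congrArg (dunkl₀ n k) hs
      rw [dunkl₀_add, dunkl₀_X_zero_mul, dunkl₀_X_one_mul, dunkl₀_sub, dunkl₀_smul, dunkl₀_smul,
        reflOp_apply, dunkl₀_sum] at h
      simp only [dunkl₀_tau] at h
      rw [h, hsymm]
      push_cast
      rw [add_smul] at e₀
      rw [add_smul, add_smul, one_smul]
      linear_combination e₀
    · have h := congrArg (dunkl₁ n k) hs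
      rw [dunkl₁_add, dunkl₁_X_zero_mul, dunkl₁_X_one_mul, dunkl₁_sub, dunkl₁_smul, dunkl₁_smul,
        reflOp_apply, dunkl₁_sum] at h
      simp only [dunkl₁_tau] at h
      rw [h, ← hsymm]
      push_cast
      rw [add_smul] at e₁
      rw [add_smul, add_smul, one_smul]
      linear_combination e₁
  induction m with
  | zero =>
    intro p hp
    refine step 0 p hp ?_
    simp only [interDeg, homogeneousComponent_zero, dunkl₀, dunkl₁, pderiv_C, divDiff_C]
    simp
  | succ m ih =>
    intro p hp
    have hd : ∀ i : Fin 2, (pderiv i p).IsHomogeneous (m + 1) := fun i => hp.pderiv (i := i)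
    refine step (m + 1) p hp ?_
    -- Commuting partial derivatives give the symmetry via the induction hypothesis; commutativity
    -- of the Dunkl operators themselves is not needed.
    rw [(ih _ (hd 1)).1, (ih _ (hd 0)).2, pderiv_pderiv_comm]

/-- The Dunkl operators turn `V p = 0` into `V ∂ᵢ p = 0`. By induction both derivatives vanish, and
Euler's identity gives `p = 0`. -/
lemma interDeg_injective {n : ℕ} [NeZero n] {k : ℂ} (hγ : 0 < (gam n k).re) (m : ℕ) :
    ∀ p : Poly, p.IsHomogeneous m → interDeg n k m p = 0 → p = 0 := by
  induction m with
  | zero =>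
    intro p hp h
    rwa [interDeg, homogeneousComponent_eq_self hp] at h
  | succ m ih =>
    intro p hp h
    have hd : ∀ i : Fin 2, (pderiv i p).IsHomogeneous m := fun i => hp.pderiv (i := i)
    have h2 := dunkl_interDeg hγ m p hp
    rw [h, dunkl₀_zero, dunkl₁_zero] at h2
    have h3 := hp.sum_X_mul_pderiv
    rw [Fin.sum_univ_two, ih _ (hd 0) h2.1.symm, ih _ (hd 1) h2.2.symm, mul_zero, mul_zero,
      add_zero] at h3
    exact (smul_eq_zero_iff_right (Nat.succ_ne_zero m)).1 h3.symm

/-- A linear map that preserves homogeneous polynomials and their degree, and is injective on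
them, is bijective. -/
lemma bijective_of_isHomogeneous {σ : Type*} [Finite σ]
    (V : MvPolynomial σ ℂ →ₗ[ℂ] MvPolynomial σ ℂ)
    (hV : ∀ m p, p.IsHomogeneous m → (V p).IsHomogeneous m)
    (hinj : ∀ m p, p.IsHomogeneous m → V p = 0 → p = 0) : Function.Bijective V := by
  have hcomp : ∀ m p, homogeneousComponent m (V p) = V (homogeneousComponent m p) := by
    intro m p
    conv_lhs => rw [← sum_homogeneousComponent p]
    rw [map_sum, map_sum]
    have : ∀ i, homogeneousComponent m (V (homogeneousComponent i p)) =
        if m = i then V (homogeneousComponent i p) else 0 := fun i =>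
      homogeneousComponent_of_mem (hV i _ (homogeneousComponent_isHomogeneous i p))
    simp_rw [this]
    rw [Finset.sum_ite_eq]
    split_ifs with h
    · rfl
    · rw [homogeneousComponent_eq_zero, map_zero]
      simpa [Nat.lt_succ_iff] using h
  constructor
  · refine (injective_iff_map_eq_zero V).2 fun p hp => ?_
    rw [← sum_homogeneousComponent p]
    refine Finset.sum_eq_zero fun i _ => hinj i _ (homogeneousComponent_isHomogeneous i p) ?_
    rw [← hcomp, hp, map_zero]
  · intro p
    -- Each homogeneous piece is finite-dimensional and stable under `V`, so injectivity implies
    -- surjectivity there.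
    have hs : ∀ m, ∃ q, V q = homogeneousComponent m p := fun m => by
      have : Module.Finite ℂ (homogeneousSubmodule σ ℂ m) :=
        Module.Finite.iff_fg.2 (homogeneousSubmodule_fg σ ℂ m)
      have hVm : ∀ q ∈ homogeneousSubmodule σ ℂ m, V q ∈ homogeneousSubmodule σ ℂ m := hV m
      have hi : Function.Injective (V.restrict hVm) :=
        (injective_iff_map_eq_zero _).2 fun q hq =>
          Subtype.ext (hinj m q q.2 (congrArg Subtype.val hq))
      obtain ⟨q, hq⟩ := LinearMap.injective_iff_surjective.1 hi
        ⟨_, homogeneousComponent_mem m p⟩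
      exact ⟨q, congrArg Subtype.val hq⟩
    choose q hq using hs
    refine ⟨∑ i ∈ Finset.range (p.totalDegree + 1), q i, ?_⟩
    simp_rw [map_sum, hq, sum_homogeneousComponent]

/-- The intertwining operator in complex coordinates. -/
def inter (n : ℕ) (k : ℂ) : Poly →ₗ[ℂ] Poly :=
  (basisMonomials (Fin 2) ℂ).constr ℂ fun s => interDeg n k s.degree (monomial s 1)

lemma inter_eq {n : ℕ} {k : ℂ} {m : ℕ} {p : Poly} (hp : p.IsHomogeneous m) :
    inter n k p = interDeg n k m p := by
  rw [← support_sum_monomial_coeff p, map_sum, map_sum]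
  refine Finset.sum_congr rfl fun s hs => ?_
  have h1 : monomial s (coeff s p) = coeff s p • basisMonomials (Fin 2) ℂ s := by
    rw [coe_basisMonomials, smul_monomial, smul_eq_mul, mul_one]
  have h2 : s.degree = m := by
    by_contra h
    exact (mem_support_iff.1 hs) (hp.coeff_eq_zero h)
  rw [h1, map_smul, map_smul, inter, Module.Basis.constr_basis, h2, coe_basisMonomials]

lemma inter_one (n : ℕ) (k : ℂ) : inter n k 1 = 1 := by
  rw [inter_eq (isHomogeneous_one _ _), interDeg]
  simp

lemma isHomogeneous_inter {n : ℕ} {k : ℂ} {m : ℕ} {p : Poly} (hp : p.IsHomogeneous m) :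
    (inter n k p).IsHomogeneous m := by
  rw [inter_eq hp]
  exact isHomogeneous_interDeg n k m hp

lemma bijective_inter {n : ℕ} [NeZero n] {k : ℂ} (hγ : 0 < (gam n k).re) :
    Function.Bijective (inter n k) :=
  bijective_of_isHomogeneous _ (fun _ _ hp => isHomogeneous_inter hp) fun m p hp h =>
    interDeg_injective hγ m p hp (by rwa [← inter_eq hp])

lemma dunkl_inter {n : ℕ} [NeZero n] {k : ℂ} (hγ : 0 < (gam n k).re) (p : Poly) :
    dunkl₀ n k (inter n k p) = inter n k (pderiv 0 p) ∧
      dunkl₁ n k (inter n k p) = inter n k (pderiv 1 p) := by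
  have h : ∀ m, ∀ p : Poly, p.IsHomogeneous m →
      dunkl₀ n k (inter n k p) = inter n k (pderiv 0 p) ∧
      dunkl₁ n k (inter n k p) = inter n k (pderiv 1 p) := by
    intro m p hp
    cases m with
    | zero =>
      obtain ⟨c, rfl⟩ : ∃ c, p = C c := ⟨_, totalDegree_eq_zero_iff_eq_C.1
        ((totalDegree_zero_iff_isHomogeneous _).2 hp)⟩
      rw [inter_eq hp, interDeg, homogeneousComponent_zero]
      simp [dunkl₀, dunkl₁, divDiff_C]
    | succ m =>
      have hd : ∀ i : Fin 2, (pderiv i p).IsHomogeneous m := fun i => hp.pderiv (i := i)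
      rw [inter_eq hp, inter_eq (hd 0), inter_eq (hd 1)]
      exact dunkl_interDeg hγ m p hp
  rw [← sum_homogeneousComponent p]
  simp_rw [map_sum, dunkl₀_sum, dunkl₁_sum]
  exact ⟨Finset.sum_congr rfl fun i _ => (h i _ (homogeneousComponent_isHomogeneous i p)).1,
    Finset.sum_congr rfl fun i _ => (h i _ (homogeneousComponent_isHomogeneous i p)).2⟩

/-! ### Change of coordinates -/

/-- The function `x ↦ q (x, conj x)`. -/
def cpxEval (q : Poly) (x : ℂ) : ℂ := eval ![x, conj x] q

/-- The substitution of `x₀ + i x₁` and `x₀ - i x₁` for the variables. -/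
def toReal : Poly →ₐ[ℂ] Poly := aeval ![X 0 + C Complex.I * X 1, X 0 - C Complex.I * X 1]

/-- The inverse of `toReal`. -/
def toCpx : Poly →ₐ[ℂ] Poly :=
  aeval ![C 2⁻¹ * X 0 + C 2⁻¹ * X 1, C (-(Complex.I / 2)) * X 0 + C (Complex.I / 2) * X 1]

lemma toReal_toCpx (p : Poly) : toReal (toCpx p) = p := by
  have h : toReal.comp toCpx = AlgHom.id ℂ Poly := by
    refine MvPolynomial.algHom_ext fun s => ?_
    have h1 : (C 2⁻¹ : Poly) + C 2⁻¹ = 1 := by rw [← C_add, ← C_1]; norm_num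
    have h2 : (C Complex.I : Poly) * C (Complex.I / 2) = -C 2⁻¹ := by
      rw [← C_mul, ← C_neg, ← mul_div_assoc, Complex.I_mul_I]; norm_num
    fin_cases s
    · simp [toReal, toCpx, algHom_C, algebraMap_eq]
      linear_combination (X 0 : Poly) * h1
    · simp [toReal, toCpx, algHom_C, algebraMap_eq]
      linear_combination (X 1 : Poly) * h1 - 2 * X 1 * h2
  exact DFunLike.congr_fun h p

lemma toCpx_toReal (p : Poly) : toCpx (toReal p) = p := by
  have h : toCpx.comp toReal = AlgHom.id ℂ Poly := by
    refine MvPolynomial.algHom_ext fun s => ?_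
    have h1 : (C 2⁻¹ : Poly) + C 2⁻¹ = 1 := by rw [← C_add, ← C_1]; norm_num
    have h2 : (C Complex.I : Poly) * C (Complex.I / 2) = -C 2⁻¹ := by
      rw [← C_mul, ← C_neg, ← mul_div_assoc, Complex.I_mul_I]; norm_num
    fin_cases s
    · simp [toReal, toCpx, algHom_C, algebraMap_eq]
      linear_combination (X 0 : Poly) * h1 + (X 1 - X 0) * h2
    · simp [toReal, toCpx, algHom_C, algebraMap_eq]
      linear_combination (X 1 : Poly) * h1 + (X 0 - X 1) * h2
  exact DFunLike.congr_fun h p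

lemma isHomogeneous_toReal {m : ℕ} {p : Poly} (hp : p.IsHomogeneous m) :
    (toReal p).IsHomogeneous m := by
  have := hp.aeval (n := 1)
    (![X 0 + C Complex.I * X 1, X 0 - C Complex.I * X 1] : Fin 2 → Poly) (fun s => by
      fin_cases s
      · exact (isHomogeneous_X _ _).add (isHomogeneous_C_mul_X _ _)
      · exact (isHomogeneous_X _ _).sub (isHomogeneous_C_mul_X _ _))
  rw [one_mul] at this
  exact this

lemma isHomogeneous_toCpx {m : ℕ} {p : Poly} (hp : p.IsHomogeneous m) :
    (toCpx p).IsHomogeneous m := by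
  have := hp.aeval (n := 1)
    (![C 2⁻¹ * X 0 + C 2⁻¹ * X 1,
      C (-(Complex.I / 2)) * X 0 + C (Complex.I / 2) * X 1] : Fin 2 → Poly) (fun s => by
      fin_cases s
      · exact (isHomogeneous_C_mul_X _ _).add (isHomogeneous_C_mul_X _ _)
      · exact (isHomogeneous_C_mul_X _ _).add (isHomogeneous_C_mul_X _ _))
  rw [one_mul] at this
  exact this

lemma polyFun_toReal (q : Poly) : polyFun (toReal q) = cpxEval q := by
  funext x
  have h : (aeval ![(x.re : ℂ), (x.im : ℂ)]).comp toReal =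
      (aeval ![x, conj x] : Poly →ₐ[ℂ] ℂ) := by
    refine MvPolynomial.algHom_ext fun s => ?_
    have h1 : (x.re : ℂ) + x.im * Complex.I = x := Complex.re_add_im x
    have h2 : (x.re : ℂ) - x.im * Complex.I = conj x := by
      conv_rhs => rw [← h1]
      simp only [map_add, map_mul, Complex.conj_ofReal, Complex.conj_I]
      ring
    fin_cases s
    · simp [toReal]
      linear_combination h1
    · simp [toReal]
      linear_combination h2
  simpa [aeval_eq_eval, polyFun, cpxEval] using DFunLike.congr_fun h q

lemma polyFun_eq_cpxEval (p : Poly) : polyFun p = cpxEval (toCpx p) := by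
  rw [← polyFun_toReal, toReal_toCpx]

/-- The real points form a product of infinite sets, on which a complex polynomial is determined. -/
lemma polyFun_injective : Function.Injective polyFun := by
  intro p q h
  refine MvPolynomial.funext_set (fun _ => Set.range ((↑) : ℝ → ℂ))
    (fun _ => Set.infinite_range_of_injective Complex.ofReal_injective) fun x hx => ?_
  obtain ⟨a, ha⟩ := hx 0 (Set.mem_univ 0)
  obtain ⟨b, hb⟩ := hx 1 (Set.mem_univ 1)
  have hx2 : x = ![((⟨a, b⟩ : ℂ).re : ℂ), ((⟨a, b⟩ : ℂ).im : ℂ)] := by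
    funext s
    fin_cases s
    · exact ha.symm
    · exact hb.symm
  rw [hx2]
  exact congrFun h ⟨a, b⟩

lemma cpxEval_injective : Function.Injective cpxEval := by
  intro p q h
  rw [← polyFun_toReal, ← polyFun_toReal] at h
  rw [← toCpx_toReal p, polyFun_injective h, toCpx_toReal]

lemma toReal_X_zero : toReal (X 0) = X 0 + C Complex.I * X 1 := by simp [toReal]

lemma toReal_X_one : toReal (X 1) = X 0 - C Complex.I * X 1 := by simp [toReal]

lemma toReal_C (c : ℂ) : toReal (C c) = C c := by simp [toReal, algHom_C]

lemma pderiv_toReal (q : Poly) :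
    pderiv 0 (toReal q) = toReal (pderiv 0 q) + toReal (pderiv 1 q) ∧
      pderiv 1 (toReal q) = C Complex.I * (toReal (pderiv 0 q) - toReal (pderiv 1 q)) := by
  have h01 := pderiv_X_of_ne (R := ℂ) (show (0 : Fin 2) ≠ 1 by decide)
  have h10 := pderiv_X_of_ne (R := ℂ) (show (1 : Fin 2) ≠ 0 by decide)
  induction q using MvPolynomial.induction_on with
  | C c => simp
  | add p q hp hq =>
    simp only [map_add, hp, hq]
    constructor <;> ring
  | mul_X p i hp =>
    simp only [Derivation.leibniz, map_add, map_mul, smul_eq_mul, hp]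
    fin_cases i
    · simp only [Fin.zero_eta, toReal_X_zero, h01, pderiv_X_self, map_add, map_one, map_zero,
        Derivation.leibniz, smul_eq_mul, pderiv_C, h10]
      constructor <;> ring
    · simp only [Fin.mk_one, toReal_X_one, h01, pderiv_X_self, map_sub, map_one, map_zero,
        Derivation.leibniz, smul_eq_mul, pderiv_C, h10]
      constructor <;> ring

lemma polyDeriv_toReal (ξ : ℂ) (q : Poly) :
    polyDeriv ξ (toReal q) = toReal (ξ • pderiv 0 q + conj ξ • pderiv 1 q) := by
  have h1 : C ξ = (C (ξ.re : ℂ) + C (ξ.im : ℂ) * C Complex.I : Poly) := by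
    rw [← C_mul, ← C_add, Complex.re_add_im]
  have h2 : C (conj ξ) = (C (ξ.re : ℂ) - C (ξ.im : ℂ) * C Complex.I : Poly) := by
    rw [← C_mul, ← C_sub]
    congr 1
    conv_lhs => rw [← Complex.re_add_im ξ]
    simp only [map_add, map_mul, Complex.conj_ofReal, Complex.conj_I]
    ring
  rw [polyDeriv, (pderiv_toReal q).1, (pderiv_toReal q).2, smul_eq_C_mul, smul_eq_C_mul,
    smul_eq_C_mul, smul_eq_C_mul, map_add, map_mul, map_mul, toReal_C, toReal_C, h1, h2]
  ring

/-- The real derivative with Wirtinger derivatives `a` and `b`. -/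
def wirtinger (a b : ℂ) : ℂ →L[ℝ] ℂ :=
  a • ContinuousLinearMap.id ℝ ℂ + b • (Complex.conjCLE : ℂ →L[ℝ] ℂ)

lemma wirtinger_apply (a b ξ : ℂ) : wirtinger a b ξ = a * ξ + b * conj ξ := by
  simp [wirtinger]

lemma hasFDerivAt_cpxEval (q : Poly) (x : ℂ) :
    HasFDerivAt (cpxEval q) (wirtinger (cpxEval (pderiv 0 q) x) (cpxEval (pderiv 1 q) x)) x := by
  have h01 := pderiv_X_of_ne (R := ℂ) (show (0 : Fin 2) ≠ 1 by decide)
  have h10 := pderiv_X_of_ne (R := ℂ) (show (1 : Fin 2) ≠ 0 by decide)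
  induction q using MvPolynomial.induction_on with
  | C c =>
    have h0 : cpxEval (C c) = fun _ => c := by funext y; simp [cpxEval]
    rw [h0]
    refine (hasFDerivAt_const c x).congr_fderiv (ContinuousLinearMap.ext fun ξ => ?_)
    simp [wirtinger_apply, cpxEval]
  | add p q hp hq =>
    have h0 : cpxEval (p + q) = cpxEval p + cpxEval q := by funext y; simp [cpxEval]
    rw [h0]
    refine (hp.add hq).congr_fderiv (ContinuousLinearMap.ext fun ξ => ?_)
    simp [wirtinger_apply, cpxEval]
    ring
  | mul_X p i hp =>
    have h0 : cpxEval (p * X i) = fun y => cpxEval p y * cpxEval (X i) y := by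
      funext y; simp [cpxEval]
    rw [h0]
    have hX : HasFDerivAt (cpxEval (X i))
        (wirtinger (cpxEval (pderiv 0 (X i)) x) (cpxEval (pderiv 1 (X i)) x)) x := by
      fin_cases i
      · have h0 : cpxEval (X 0) = fun y => y := by funext y; simp [cpxEval]
        simp only [Fin.zero_eta, h0]
        refine (hasFDerivAt_id (𝕜 := ℝ) x).congr_fderiv (ContinuousLinearMap.ext fun ξ => ?_)
        simp [wirtinger_apply, cpxEval, h01]
      · have h0 : cpxEval (X 1) = fun y => conj y := by funext y; simp [cpxEval]
        simp only [Fin.mk_one, h0]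
        refine ((Complex.conjCLE : ℂ →L[ℝ] ℂ).hasFDerivAt (x := x)).congr_fderiv
          (ContinuousLinearMap.ext fun ξ => ?_)
        simp [wirtinger_apply, cpxEval, h10]
    refine (hp.mul hX).congr_fderiv (ContinuousLinearMap.ext fun ξ => ?_)
    simp [wirtinger_apply, cpxEval, Derivation.leibniz]
    ring

lemma cpxEval_tau (n : ℕ) (j : Fin n) (q : Poly) (x : ℂ) :
    cpxEval (tau n j q) x = cpxEval q (omega n j * conj x) := by
  rw [cpxEval, cpxEval, eval_tau, map_mul, conj_omega, Complex.conj_conj]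

/-- The quotient `⟪α, ξ⟫ / ⟪α, x⟫` equals `(ξ - ω ξ̄) / (x - ω x̄)`, whose denominator is the value
of the root form. The analytic operator thus becomes the algebraic divided difference, on the
mirrors too. -/
lemma dunklOp_cpxEval (n : ℕ) (k ξ : ℂ) (q : Poly) (x : ℂ) :
    dunklOp n k ξ (cpxEval q) x =
      cpxEval (ξ • dunkl₀ n k q + conj ξ • dunkl₁ n k q) x := by
  have hj : ∀ j : Fin n, k * (⟪root n j, ξ⟫_ℝ : ℂ) *
    (if ⟪root n j, x⟫_ℝ = 0 then (2 / ‖root n j‖ ^ 2 : ℝ) * fderiv ℝ (cpxEval q) x (root n j)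
     else (cpxEval q x - cpxEval q (reflection (root n j) x)) / (⟪root n j, x⟫_ℝ : ℂ)) =
     k * ((ξ - omega n j * conj ξ) * cpxEval (divDiff n j q) x) := by
    intro j
    have hv := pow_ne_zero (j : ℕ) (w_ne_zero n)
    have hω : omega n j = (w n ^ (j : ℕ)) ^ 2 := by rw [omega, mul_comm, pow_mul]
    have key := rootForm_mul_divDiff n j q
    split_ifs with h
    · have hx := (inner_root_eq_zero_iff n j x).1 h
      -- On the mirror the value of `divDiff` is recovered by differentiating `rootForm * divDiff =
      -- q - τ q`, because the root form vanishes there.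
      have h1 := congrArg (fun p => cpxEval (pderiv 0 p) x) key
      have h2 : cpxEval (rootForm n j) x = 0 := by
        simp [cpxEval, rootForm, hx]
      have h3 : cpxEval (pderiv 0 (rootForm n j)) x = 1 := by
        simp [cpxEval, rootForm, pderiv_X_of_ne (R := ℂ) (show (1 : Fin 2) ≠ 0 by decide)]
      have h4 : cpxEval (divDiff n j q) x =
          cpxEval (pderiv 0 q) x - (omega n j)⁻¹ * cpxEval (pderiv 1 q) x := by
        have h5 := cpxEval_tau n j (pderiv 1 q) x
        rw [hx] at h5
        simp only [Derivation.leibniz, map_sub, (pderiv_tau n j q).1] at h1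
        simp only [cpxEval, smul_eq_mul, map_add, map_mul, map_sub, eval_C] at h1 h2 h3 h5 ⊢
        rw [h2, h3, h5] at h1
        linear_combination h1
      rw [(hasFDerivAt_cpxEval q x).fderiv, wirtinger_apply, h4, norm_root, ofReal_inner_root,
        root, map_mul, map_pow, conj_w, Complex.conj_I, hω, inv_pow]
      push_cast
      field_simp
      rw [Complex.I_sq]
      ring
    · have hx : ((⟪root n j, x⟫_ℝ : ℝ) : ℂ) ≠ 0 := Complex.ofReal_ne_zero.2 h
      have h1 := congrArg (fun p => cpxEval p x) key
      have h2 : (x - omega n j * conj x) * cpxEval (divDiff n j q) x =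
          cpxEval q x - cpxEval q (omega n j * conj x) := by
        rw [← cpxEval_tau]
        simpa [cpxEval, rootForm] using h1
      rw [reflection_root, ← h2, mul_assoc, mul_div_assoc', mul_div_assoc]
      rw [ofReal_inner_root] at hx
      rw [ofReal_inner_root, ofReal_inner_root]
      have h3 := right_ne_zero_of_mul hx
      field_simp
  rw [dunklOp, Finset.sum_congr rfl fun j _ => hj j, (hasFDerivAt_cpxEval q x).fderiv,
    wirtinger_apply, ← Finset.mul_sum]
  simp only [cpxEval, dunkl₀, dunkl₁, map_add, map_sub, smul_eval, map_sum, map_mul, eval_C,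
    sub_mul, Finset.sum_sub_distrib, ← Finset.mul_sum, mul_assoc, mul_left_comm _ (conj ξ)]
  ring

/-! ### Existence and uniqueness of the intertwining operator -/

lemma exists_isIntertwining {n : ℕ} [NeZero n] {k : ℂ} (hγ : 0 < (gam n k).re) :
    ∃ V, IsIntertwining n k V := by
  refine ⟨toReal.toLinearMap ∘ₗ inter n k ∘ₗ toCpx.toLinearMap, ?_, ?_, ?_, ?_⟩
  · have h1 : Function.Bijective toReal :=
      ⟨Function.LeftInverse.injective toCpx_toReal, Function.RightInverse.surjective toReal_toCpx⟩
    have h2 : Function.Bijective toCpx :=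
      ⟨Function.LeftInverse.injective toReal_toCpx, Function.RightInverse.surjective toCpx_toReal⟩
    exact h1.comp ((bijective_inter hγ).comp h2)
  · intro m p hp
    have h : (toReal (inter n k (toCpx p))).IsHomogeneous m :=
      isHomogeneous_toReal (isHomogeneous_inter (isHomogeneous_toCpx hp))
    exact h
  · simp [inter_one]
  · intro ξ p x
    have hp : polyDeriv ξ p = toReal (ξ • pderiv 0 (toCpx p) + conj ξ • pderiv 1 (toCpx p)) := by
      rw [← polyDeriv_toReal, toReal_toCpx]
    simp only [LinearMap.comp_apply, AlgHom.toLinearMap_apply, polyFun_toReal, dunklOp_cpxEval, hp,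
      toCpx_toReal, map_add, map_smul, (dunkl_inter hγ _).1, (dunkl_inter hγ _).2]
    rw [← polyFun_toReal]
    simp only [map_add, map_smul]

lemma IsIntertwining.dunkl {n : ℕ} {k : ℂ} {V : Poly →ₗ[ℂ] Poly} (hV : IsIntertwining n k V)
    (ξ : ℂ) (p : Poly) :
    ξ • dunkl₀ n k (toCpx (V p)) + conj ξ • dunkl₁ n k (toCpx (V p)) =
      toCpx (V (polyDeriv ξ p)) := by
  refine cpxEval_injective (funext fun x => ?_)
  rw [← dunklOp_cpxEval, ← polyFun_eq_cpxEval, ← polyFun_eq_cpxEval, hV.intertwines]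

/-- The directions `1` and `i` separate the two complex operators. Both vanish on `p`, so the radial
operator does too, and it is invertible in positive degree. -/
lemma eq_zero_of_dunkl_eq_zero {n : ℕ} [NeZero n] {k : ℂ} (hγ : 0 < (gam n k).re) {m : ℕ}
    {p : Poly} (hp : p.IsHomogeneous (m + 1))
    (h : ∀ ξ : ℂ, ξ • dunkl₀ n k p + conj ξ • dunkl₁ n k p = 0) : p = 0 := by
  have h1 := h 1
  have h2 := h Complex.I
  rw [map_one, one_smul, one_smul] at h1
  rw [Complex.conj_I, neg_smul, ← sub_eq_add_neg, ← smul_sub, smul_eq_zero_iff_right Complex.I_ne_zero,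
    sub_eq_zero] at h2
  rw [h2, ← two_smul ℂ, smul_eq_zero_iff_right two_ne_zero] at h1
  have h3 := X_mul_dunkl n k hp
  rw [h2, h1, mul_zero, mul_zero, add_zero] at h3
  have hinv := resolvent_mul (A := Module.End ℂ Poly) (n := n) (k := k) (m := ((m + 1 : ℕ) : ℂ))
    (reflOp_pow_three n) (Nat.cast_ne_zero.2 (Nat.succ_ne_zero m))
    (by simpa using gam_add_ne_zero hγ (m := (m + 1 : ℕ)) (by positivity))
    (by simpa using two_gam_add_ne_zero hγ (m := (m + 1 : ℕ)) (by positivity))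
  have h4 := congrArg (resolvent (A := Module.End ℂ Poly) n k ((m + 1 : ℕ) : ℂ) (reflOp n)) h3
  rw [map_zero] at h4
  exact (h4.trans (LinearMap.congr_fun hinv p)).symm

lemma dunkl_sub_eq {n : ℕ} {k ξ : ℂ} (p q : Poly) :
    ξ • dunkl₀ n k (p - q) + conj ξ • dunkl₁ n k (p - q) =
      (ξ • dunkl₀ n k p + conj ξ • dunkl₁ n k p) -
      (ξ • dunkl₀ n k q + conj ξ • dunkl₁ n k q) := by
  rw [dunkl₀_sub, dunkl₁_sub, smul_sub, smul_sub]
  abel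

lemma isHomogeneous_polyDeriv {m : ℕ} {p : Poly} (hp : p.IsHomogeneous (m + 1)) (ξ : ℂ) :
    (polyDeriv ξ p).IsHomogeneous m :=
  (isHomogeneous_smul _ hp.pderiv).add (isHomogeneous_smul _ hp.pderiv)

/-- By induction on the degree: the Dunkl operators send `V p - V' p` to a difference in lower
degree, which is zero. -/
lemma IsIntertwining.unique {n : ℕ} [NeZero n] {k : ℂ} (hγ : 0 < (gam n k).re)
    {V V' : Poly →ₗ[ℂ] Poly} (hV : IsIntertwining n k V) (hV' : IsIntertwining n k V') :
    V = V' := by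
  have h : ∀ m, ∀ p : Poly, p.IsHomogeneous m → V p = V' p := by
    intro m
    induction m with
    | zero =>
      intro p hp
      obtain ⟨c, rfl⟩ : ∃ c, p = C c := ⟨_, totalDegree_eq_zero_iff_eq_C.1
        ((totalDegree_zero_iff_isHomogeneous _).2 hp)⟩
      have : (C c : Poly) = c • 1 := by rw [smul_eq_C_mul, mul_one]
      rw [this, map_smul, map_smul, hV.map_one, hV'.map_one]
    | succ m ih =>
      intro p hp
      have h1 := (isHomogeneous_toCpx (hV.isHomogeneous _ _ hp)).sub
        (isHomogeneous_toCpx (hV'.isHomogeneous _ _ hp))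
      have h2 := eq_zero_of_dunkl_eq_zero hγ h1 fun ξ => by
        rw [dunkl_sub_eq, hV.dunkl, hV'.dunkl, ih _ (isHomogeneous_polyDeriv hp ξ), sub_self]
      rw [← toReal_toCpx (V p), sub_eq_zero.1 h2, toReal_toCpx]
  refine LinearMap.ext fun p => ?_
  rw [← sum_homogeneousComponent p, map_sum, map_sum]
  exact Finset.sum_congr rfl fun i _ => h i _ (homogeneousComponent_isHomogeneous i p)

lemma isIntertwining_intertwiningOp {n : ℕ} [NeZero n] {k : ℂ} (hγ : 0 < (gam n k).re) :
    IsIntertwining n k (intertwiningOp n k) :=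
  Classical.epsilon_spec (exists_isIntertwining hγ)

/-! ### The homogeneous components of the Dunkl kernel -/

/-- The polynomial `E_m(·, y)` in complex coordinates. -/
def kernelPoly (n : ℕ) (k : ℂ) (m : ℕ) (y : ℂ) : Poly :=
  (1 / (m.factorial : ℂ)) • toCpx (intertwiningOp n k (linPoly y ^ m))

lemma cpxEval_kernelPoly (n : ℕ) (k : ℂ) (m : ℕ) (x y : ℂ) :
    cpxEval (kernelPoly n k m y) x = dunklE n k m x y := by
  rw [dunklE, polyFun_eq_cpxEval, kernelPoly, cpxEval, cpxEval, smul_eval]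

lemma isHomogeneous_linPoly (y : ℂ) : (linPoly y).IsHomogeneous 1 :=
  (isHomogeneous_smul _ (isHomogeneous_X _ _)).add (isHomogeneous_smul _ (isHomogeneous_X _ _))

lemma polyDeriv_linPoly_pow (ξ y : ℂ) (m : ℕ) :
    polyDeriv ξ (linPoly y ^ (m + 1)) = (((m : ℂ) + 1) * (⟪ξ, y⟫_ℝ : ℂ)) • linPoly y ^ m := by
  have h : (⟪ξ, y⟫_ℝ : ℝ) = ξ.re * y.re + ξ.im * y.im := by
    rw [Complex.inner]; simp; ring
  have h0 : pderiv 0 (linPoly y) = C (y.re : ℂ) := by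
    simp [linPoly, smul_eq_C_mul, pderiv_X_of_ne (R := ℂ) (show (1 : Fin 2) ≠ 0 by decide)]
  have h1 : pderiv 1 (linPoly y) = C (y.im : ℂ) := by
    simp [linPoly, smul_eq_C_mul, pderiv_X_of_ne (R := ℂ) (show (0 : Fin 2) ≠ 1 by decide)]
  rw [polyDeriv, pderiv_pow, pderiv_pow, h0, h1, h]
  simp only [smul_eq_C_mul, Nat.add_sub_cancel]
  push_cast
  simp only [C_mul, C_add, C_1, map_natCast]
  ring

lemma isHomogeneous_kernelPoly {n : ℕ} [NeZero n] {k : ℂ} (hγ : 0 < (gam n k).re) (m : ℕ)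
    (y : ℂ) : (kernelPoly n k m y).IsHomogeneous m := by
  refine isHomogeneous_smul _ (isHomogeneous_toCpx
    ((isIntertwining_intertwiningOp hγ).isHomogeneous _ _ ?_))
  simpa using (isHomogeneous_linPoly y).pow m

lemma kernelPoly_zero {n : ℕ} [NeZero n] {k : ℂ} (hγ : 0 < (gam n k).re) (y : ℂ) :
    kernelPoly n k 0 y = 1 := by
  simp [kernelPoly, (isIntertwining_intertwiningOp hγ).map_one]

lemma dunkl_kernelPoly_succ {n : ℕ} [NeZero n] {k : ℂ} (hγ : 0 < (gam n k).re) (m : ℕ)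
    (y ξ : ℂ) :
    ξ • dunkl₀ n k (kernelPoly n k (m + 1) y) + conj ξ • dunkl₁ n k (kernelPoly n k (m + 1) y) =
      (⟪ξ, y⟫_ℝ : ℂ) • kernelPoly n k m y := by
  have h := (isIntertwining_intertwiningOp hγ).dunkl ξ (linPoly y ^ (m + 1))
  rw [polyDeriv_linPoly_pow, map_smul, map_smul] at h
  rw [kernelPoly, dunkl₀_smul, dunkl₁_smul, smul_comm ξ, smul_comm (conj ξ), ← smul_add, h,
    smul_smul, kernelPoly, smul_smul]
  congr 1
  have h1 : (m.factorial : ℂ) ≠ 0 := Nat.cast_ne_zero.2 m.factorial_ne_zero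
  have h2 : (m : ℂ) + 1 ≠ 0 := Nat.cast_add_one_ne_zero m
  rw [Nat.factorial_succ]
  push_cast
  field_simp

lemma kernelPoly_recursion {n : ℕ} [NeZero n] {k : ℂ} (hγ : 0 < (gam n k).re) (m : ℕ) (y : ℂ) :
    (((m + 1 : ℕ) : ℂ) + gam n k) • kernelPoly n k (m + 1) y -
        k • reflOp n (kernelPoly n k (m + 1) y) =
      (C (conj y / 2) * X 0 + C (y / 2) * X 1) * kernelPoly n k m y := by
  rw [← X_mul_dunkl n k (isHomogeneous_kernelPoly hγ (m + 1) y)]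
  refine cpxEval_injective (funext fun x => ?_)
  have h := congrArg (fun p => cpxEval p x) (dunkl_kernelPoly_succ hγ m y x)
  simp only [cpxEval, map_add, map_mul, smul_eval, eval_X, eval_C, ofReal_inner,
    Matrix.cons_val_zero, Matrix.cons_val_one] at h ⊢
  rw [h]
  ring

/-- The arguments `a` and `b` are independent complex numbers, not only `x` and `conj x`, so that
Cauchy's estimate can later be applied on complex lines. -/
lemma eval_kernelPoly_recursion {n : ℕ} [NeZero n] {k : ℂ} (hγ : 0 < (gam n k).re) (m : ℕ)
    (y a b : ℂ) :
    (((m + 1 : ℕ) : ℂ) + gam n k) * eval ![a, b] (kernelPoly n k (m + 1) y) -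
        k * ∑ j, eval ![omega n j * b, (omega n j)⁻¹ * a] (kernelPoly n k (m + 1) y) =
      (conj y * a + y * b) / 2 * eval ![a, b] (kernelPoly n k m y) := by
  have h := congrArg (eval ![a, b]) (kernelPoly_recursion hγ m y)
  simp only [map_sub, map_add, map_mul, smul_eval, eval_X, eval_C, reflOp_apply, map_sum, eval_tau,
    Matrix.cons_val_zero, Matrix.cons_val_one] at h
  rw [h]
  ring

/-! ### Factorial decay of the homogeneous components. -/

lemma sum_sub_right {n : ℕ} [NeZero n] {M : Type*} [AddCommMonoid M] (l : Fin n) (f : Fin n → M) :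
    ∑ j, f (j - l) = ∑ j, f j :=
  Equiv.sum_comp (Equiv.subRight l) f

/-- The sum of the squares of the values on the orbit of `(a, b)`. -/
lemma sum_sq_kernelPoly_le {n : ℕ} [NeZero n] {k : ℂ} (hγ : 0 < (gam n k).re) (m : ℕ)
    (y a b : ℂ) :
    ∑ j, (‖eval ![omega n j * a, (omega n j)⁻¹ * b] (kernelPoly n k m y)‖ ^ 2 +
      ‖eval ![omega n j * b, (omega n j)⁻¹ * a] (kernelPoly n k m y)‖ ^ 2) ≤
      2 * n * ((‖y‖ * (‖a‖ + ‖b‖) / 2) ^ m / m.factorial) ^ 2 := by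
  induction m with
  | zero =>
    rw [kernelPoly_zero hγ]
    simp
    linarith
  | succ m ih =>
    -- The radial recursion on the orbit of `(a, b)`: its source is `E_m` times linear forms of
    -- modulus at most `R`, so each degree gains a factor `R / (m + 1)`.
    have hb := orbit_bound hγ.le (m := (m + 1 : ℕ))
      (fun j => eval ![omega n j * a, (omega n j)⁻¹ * b] (kernelPoly n k (m + 1) y))
      (fun j => eval ![omega n j * b, (omega n j)⁻¹ * a] (kernelPoly n k (m + 1) y))
      (fun j => (conj y * (omega n j * a) + y * ((omega n j)⁻¹ * b)) / 2 *
        eval ![omega n j * a, (omega n j)⁻¹ * b] (kernelPoly n k m y))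
      (fun j => (conj y * (omega n j * b) + y * ((omega n j)⁻¹ * a)) / 2 *
        eval ![omega n j * b, (omega n j)⁻¹ * a] (kernelPoly n k m y)) (by positivity)
      (fun j => by
        rw [← eval_kernelPoly_recursion hγ m y (omega n j * a) ((omega n j)⁻¹ * b),
          ← sum_sub_right j]
        simp only [omega_sub, mul_inv, inv_inv, ← mul_assoc, Complex.ofReal_natCast])
      (fun j => by
        rw [← eval_kernelPoly_recursion hγ m y (omega n j * b) ((omega n j)⁻¹ * a),
          ← sum_sub_right j]
        simp only [omega_sub, mul_inv, inv_inv, ← mul_assoc, Complex.ofReal_natCast])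
    set R := ‖y‖ * (‖a‖ + ‖b‖) / 2 with hR
    have hR0 : 0 ≤ R := by positivity
    have hd : ∀ (j : Fin n) (c d e : ℂ), ‖c‖ + ‖d‖ = ‖a‖ + ‖b‖ →
        ‖(conj y * (omega n j * c) + y * ((omega n j)⁻¹ * d)) / 2 * e‖ ^ 2 ≤ R ^ 2 * ‖e‖ ^ 2 := by
      intro j c d e hcd
      rw [norm_mul, mul_pow]
      gcongr
      rw [norm_div, Complex.norm_ofNat, hR]
      gcongr
      refine (norm_add_le _ _).trans (le_of_eq ?_)
      simp only [norm_mul, norm_inv, norm_omega, RCLike.norm_conj]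
      rw [← hcd]
      ring
    have h2 : ((m + 1 : ℕ) : ℝ) ^ 2 * ∑ j,
        (‖eval ![omega n j * a, (omega n j)⁻¹ * b] (kernelPoly n k (m + 1) y)‖ ^ 2 +
          ‖eval ![omega n j * b, (omega n j)⁻¹ * a] (kernelPoly n k (m + 1) y)‖ ^ 2) ≤
        R ^ 2 * (2 * n * (R ^ m / m.factorial) ^ 2) := by
      refine hb.trans (le_trans ?_ (mul_le_mul_of_nonneg_left ih (sq_nonneg R)))
      rw [Finset.mul_sum]
      refine Finset.sum_le_sum fun j _ => ?_
      rw [mul_add]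
      exact add_le_add (hd j a b _ rfl) (hd j b a _ (add_comm _ _))
    have h3 : (0 : ℝ) < ((m + 1 : ℕ) : ℝ) ^ 2 := by positivity
    refine le_of_mul_le_mul_left (h2.trans (le_of_eq ?_)) h3
    rw [Nat.factorial_succ, pow_succ R m]
    push_cast
    have : (m.factorial : ℝ) ≠ 0 := Nat.cast_ne_zero.2 m.factorial_ne_zero
    field_simp

lemma norm_eval_kernelPoly_le {n : ℕ} [NeZero n] {k : ℂ} (hγ : 0 < (gam n k).re) (m : ℕ)
    (y a b : ℂ) :
    ‖eval ![a, b] (kernelPoly n k m y)‖ ≤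
      2 * n * ((‖y‖ * (‖a‖ + ‖b‖) / 2) ^ m / m.factorial) := by
  have h := sum_sq_kernelPoly_le hγ m y a b
  have hn : (1 : ℝ) ≤ n := by exact_mod_cast Nat.one_le_iff_ne_zero.2 (NeZero.ne n)
  set r := (‖y‖ * (‖a‖ + ‖b‖) / 2) ^ m / m.factorial with hr
  have hr0 : 0 ≤ r := by positivity
  refine le_of_sq_le_sq ?_ (by positivity)
  have h2 := (Finset.single_le_sum (f := fun j : Fin n =>
    (‖eval ![omega n j * a, (omega n j)⁻¹ * b] (kernelPoly n k m y)‖ ^ 2 +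
      ‖eval ![omega n j * b, (omega n j)⁻¹ * a] (kernelPoly n k m y)‖ ^ 2))
      (fun j _ => by positivity) (Finset.mem_univ 0)).trans h
  simp only [omega_zero, one_mul, inv_one] at h2
  nlinarith [sq_nonneg ‖eval ![b, a] (kernelPoly n k m y)‖, sq_nonneg r]

/-! ### Uniqueness of the Dunkl kernel -/

/-- An energy argument along rays: let `F(t)` be the sum of `|h|²` over the orbit of `t x`. The
reflection part of the equation only decreases `F` for `t > 0`, so `F' ≤ 2 |x| |y| F`, and `F(0) =
0` forces `F = 0`. -/
lemma eq_zero_of_radial_equation {n : ℕ} [NeZero n] {k : ℂ} (hγ : 0 < (gam n k).re) {y : ℂ}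
    {h : ℂ → ℂ} (hd : Differentiable ℝ h) (h0 : h 0 = 0)
    (heq : ∀ x, fderiv ℝ h x x + gam n k * h x - k * ∑ j : Fin n, h (omega n j * conj x) =
      (⟪x, y⟫_ℝ : ℂ) * h x) (x : ℂ) : h x = 0 := by
  set U : Fin n → ℝ → ℂ := fun j t => h (t • (omega n j * x)) with hU
  set W : Fin n → ℝ → ℂ := fun j t => h (t • (omega n j * conj x)) with hW
  set F : ℝ → ℝ := fun t => ∑ j, (‖U j t‖ ^ 2 + ‖W j t‖ ^ 2) with hF
  set A := ‖x‖ * ‖y‖ with hA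
  have hder : ∀ (p : ℂ) (t : ℝ), HasDerivAt (fun s : ℝ => ‖h (s • p)‖ ^ 2)
      (2 * ⟪h (t • p), fderiv ℝ h (t • p) p⟫_ℝ) t := by
    intro p t
    have h1 : HasDerivAt (fun s : ℝ => s • p) p t := by
      simpa using (hasDerivAt_id t).smul_const p
    exact ((hd (t • p)).hasFDerivAt.comp_hasDerivAt t h1).norm_sq
  have hFd : ∀ t, HasDerivAt F (∑ j, (2 * ⟪U j t, fderiv ℝ h (t • (omega n j * x)) (omega n j * x)⟫_ℝ
      + 2 * ⟪W j t, fderiv ℝ h (t • (omega n j * conj x)) (omega n j * conj x)⟫_ℝ)) t := fun t =>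
    HasDerivAt.fun_sum fun j _ => (hder _ t).add (hder _ t)
  have hsU : ∀ (i : Fin n) (t : ℝ),
      ∑ j : Fin n, h (omega n j * conj (t • (omega n i * x))) = ∑ j, W j t := by
    intro i t
    have e := sum_omega_mul_conj n (fun z => h (t • z)) i x
    rw [hW, ← e]
    refine Finset.sum_congr rfl fun j _ => ?_
    rw [Complex.real_smul, Complex.real_smul, map_mul, Complex.conj_ofReal, mul_left_comm]
  have hsW : ∀ (i : Fin n) (t : ℝ),
      ∑ j : Fin n, h (omega n j * conj (t • (omega n i * conj x))) = ∑ j, U j t := by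
    intro i t
    have e := sum_omega_mul_conj n (fun z => h (t • z)) i (conj x)
    rw [Complex.conj_conj] at e
    rw [hU, ← e]
    refine Finset.sum_congr rfl fun j _ => ?_
    rw [Complex.real_smul, Complex.real_smul, map_mul, Complex.conj_ofReal, mul_left_comm]
  have hle : ∀ t > 0, deriv F t ≤ 2 * A * F t := by
    intro t ht
    rw [(hFd t).deriv]
    refine le_of_mul_le_mul_left ?_ ht
    have hacc := orbit_accretive hγ.le (fun j => U j t) (fun j => W j t)
    have hinner : ∀ a b : ℂ, (⟪a, b⟫_ℝ : ℝ) = (conj a * b).re := fun a b => by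
      rw [Complex.inner, mul_comm]
    -- Multiplication by `t` produces the Euler derivative at `t p`, which the radial equation
    -- expresses without derivatives.
    have key : ∀ (p : ℂ), ‖p‖ = ‖x‖ → ∀ S : ℂ,
        ∑ j : Fin n, h (omega n j * conj (t • p)) = S →
        t * (2 * ⟪h (t • p), fderiv ℝ h (t • p) p⟫_ℝ) ≤
          2 * t * A * ‖h (t • p)‖ ^ 2 -
            2 * (conj (h (t • p)) * (gam n k * h (t • p) - k * S)).re := by
      intro p hp S hS
      have e := heq (t • p)
      rw [hS, map_smul] at e
      have e2 : ((t : ℝ) : ℂ) * fderiv ℝ h (t • p) p =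
          -(gam n k * h (t • p) - k * S) + ((t * ⟪p, y⟫_ℝ : ℝ) : ℂ) * h (t • p) := by
        rw [real_inner_smul_left, Complex.real_smul] at e
        linear_combination e
      have e3 : t * ⟪h (t • p), fderiv ℝ h (t • p) p⟫_ℝ =
          -(conj (h (t • p)) * (gam n k * h (t • p) - k * S)).re +
            t * ⟪p, y⟫_ℝ * ‖h (t • p)‖ ^ 2 := by
        rw [hinner, ← Complex.re_ofReal_mul, mul_left_comm, e2, mul_add, Complex.add_re, mul_neg,
          Complex.neg_re, mul_left_comm, Complex.conj_mul', ← Complex.ofReal_pow,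
          Complex.re_ofReal_mul, Complex.ofReal_re]
      have e4 : ⟪p, y⟫_ℝ ≤ A := by
        rw [hA, ← hp]
        exact real_inner_le_norm p y
      have e5 : t * ⟪p, y⟫_ℝ * ‖h (t • p)‖ ^ 2 ≤ t * A * ‖h (t • p)‖ ^ 2 := by gcongr
      linarith
    have hn1 : ∀ j, ‖omega n j * x‖ = ‖x‖ := fun j => by rw [norm_mul, norm_omega, one_mul]
    have hn2 : ∀ j, ‖omega n j * conj x‖ = ‖x‖ := fun j => by
      rw [norm_mul, norm_omega, one_mul, RCLike.norm_conj]
    rw [Complex.re_sum] at hacc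
    rw [Finset.mul_sum]
    refine (Finset.sum_le_sum fun j _ => ?_ : _ ≤ ∑ j, (2 * t * A * (‖U j t‖ ^ 2 + ‖W j t‖ ^ 2) -
      2 * (conj (U j t) * (gam n k * U j t - k * ∑ i, W i t) +
        conj (W j t) * (gam n k * W j t - k * ∑ i, U i t)).re)).trans ?_
    · have h1 := key _ (hn1 j) _ (hsU j t)
      have h2 := key _ (hn2 j) _ (hsW j t)
      rw [mul_add, Complex.add_re]
      linarith
    · rw [Finset.sum_sub_distrib, ← Finset.mul_sum, ← Finset.mul_sum]
      have : t * (2 * A * F t) = 2 * t * A * ∑ j, (‖U j t‖ ^ 2 + ‖W j t‖ ^ 2) := by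
        rw [hF]; ring
      rw [this]
      linarith
  -- Grönwall's inequality in the form that `exp (-2 A t) F(t)` decreases from `F(0) = 0`.
  have hG : AntitoneOn (fun t => Real.exp (-(2 * A) * t) * F t) (Set.Ici 0) := by
    have hGd : ∀ t, HasDerivAt (fun t => Real.exp (-(2 * A) * t) * F t)
        (Real.exp (-(2 * A) * t) * (-(2 * A)) * F t + Real.exp (-(2 * A) * t) * deriv F t) t := by
      intro t
      have h1 : HasDerivAt (fun t : ℝ => -(2 * A) * t) (-(2 * A)) t := by
        simpa using (hasDerivAt_id t).const_mul (-(2 * A))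
      exact h1.exp.mul (hFd t).differentiableAt.hasDerivAt
    refine antitoneOn_of_deriv_nonpos (convex_Ici 0)
      (fun t _ => (hGd t).continuousAt.continuousWithinAt)
      (fun t _ => (hGd t).differentiableAt.differentiableWithinAt) fun t ht => ?_
    rw [interior_Ici, Set.mem_Ioi] at ht
    rw [(hGd t).deriv]
    have := hle t ht
    have := Real.exp_pos (-(2 * A) * t)
    nlinarith
  have hF0 : F 0 = 0 := by simp [hF, hU, hW, h0]
  have hF1 : F 1 ≤ 0 := by
    have := hG (Set.mem_Ici.2 le_rfl) (Set.mem_Ici.2 zero_le_one) zero_le_one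
    simp only [hF0, mul_zero] at this
    exact nonpos_of_mul_nonpos_right this (Real.exp_pos _)
  have h2 := (Finset.single_le_sum (f := fun j => ‖U j 1‖ ^ 2 + ‖W j 1‖ ^ 2)
    (fun j _ => by positivity) (Finset.mem_univ 0)).trans hF1
  have h3 : ‖U 0 1‖ ^ 2 ≤ 0 := by
    have := sq_nonneg ‖W 0 1‖
    have h5 : ‖U 0 1‖ ^ 2 + ‖W 0 1‖ ^ 2 ≤ 0 := h2
    linarith
  have h4 : U 0 1 = 0 := by
    rw [← norm_eq_zero, ← sq_eq_zero_iff]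
    exact le_antisymm h3 (sq_nonneg _)
  simpa [hU, omega_zero] using h4

lemma IsDunklKernel.unique {n : ℕ} [NeZero n] {k : ℂ} (hγ : 0 < (gam n k).re) {y : ℂ}
    {f g : ℂ → ℂ} (hf : IsDunklKernel n k y f) (hg : IsDunklKernel n k y g) : f = g := by
  have hfd := hf.contDiff.differentiable one_ne_zero
  have hgd := hg.contDiff.differentiable one_ne_zero
  funext x
  rw [← sub_eq_zero]
  refine eq_zero_of_radial_equation hγ (h := fun x => f x - g x) (y := y) (hfd.sub hgd)
    (by rw [hf.map_zero, hg.map_zero, sub_self]) (fun x => ?_) x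
  have h1 := hf.eigen x x
  have h2 := hg.eigen x x
  rw [dunklOp_self] at h1 h2
  rw [fderiv_fun_sub (hfd x) (hgd x), sub_apply, Finset.sum_sub_distrib]
  linear_combination h1 - h2

/-! ### Existence of the Dunkl kernel -/

lemma hasDerivAt_eval_line (q : Poly) (a b c d s : ℂ) :
    HasDerivAt (fun s => eval ![a + s * c, b + s * d] q)
      (c * eval ![a + s * c, b + s * d] (pderiv 0 q) +
        d * eval ![a + s * c, b + s * d] (pderiv 1 q)) s := by
  have h01 := pderiv_X_of_ne (R := ℂ) (show (0 : Fin 2) ≠ 1 by decide)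
  have h10 := pderiv_X_of_ne (R := ℂ) (show (1 : Fin 2) ≠ 0 by decide)
  induction q using MvPolynomial.induction_on with
  | C c => simpa using hasDerivAt_const s c
  | add p q hp hq =>
    simp only [map_add]
    exact (hp.add hq).congr_deriv (by ring)
  | mul_X p i hp =>
    simp only [map_mul, Derivation.leibniz, smul_eq_mul, map_add, eval_X]
    have hX : HasDerivAt (fun s => (![a + s * c, b + s * d] : Fin 2 → ℂ) i)
        (c * eval ![a + s * c, b + s * d] (pderiv 0 (X i)) +
        d * eval ![a + s * c, b + s * d] (pderiv 1 (X i))) s := by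
      fin_cases i
      · simpa [h01] using ((hasDerivAt_id s).mul_const c).const_add a
      · simpa [h10] using ((hasDerivAt_id s).mul_const d).const_add b
    exact (hp.mul hX).congr_deriv (by ring)

lemma norm_cpxEval_kernelPoly_le {n : ℕ} [NeZero n] {k : ℂ} (hγ : 0 < (gam n k).re) (m : ℕ)
    (y x : ℂ) :
    ‖cpxEval (kernelPoly n k m y) x‖ ≤ 2 * n * ((‖y‖ * ‖x‖) ^ m / m.factorial) := by
  refine (norm_eval_kernelPoly_le hγ m y x (conj x)).trans (le_of_eq ?_)
  rw [RCLike.norm_conj]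
  congr 3
  ring

/-- Cauchy's estimate on the unit circle of the complex line `s ↦ (x + s c, x̄ + s d)` bounds the
derivative by the values. -/
lemma norm_cpxEval_pderiv_kernelPoly_le {n : ℕ} [NeZero n] {k : ℂ} (hγ : 0 < (gam n k).re)
    (m : ℕ) (y x : ℂ) (i : Fin 2) :
    ‖cpxEval (pderiv i (kernelPoly n k m y)) x‖ ≤
      2 * n * ((‖y‖ * (‖x‖ + 1)) ^ m / m.factorial) := by
  have key : ∀ c d : ℂ, ‖c‖ ≤ 1 → ‖d‖ ≤ 1 →
      ‖c * cpxEval (pderiv 0 (kernelPoly n k m y)) x +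
        d * cpxEval (pderiv 1 (kernelPoly n k m y)) x‖ ≤
      2 * n * ((‖y‖ * (‖x‖ + 1)) ^ m / m.factorial) := by
    intro c d hc hd
    have hder := hasDerivAt_eval_line (kernelPoly n k m y) x (conj x) c d
    have h := Complex.norm_deriv_le_of_forall_mem_sphere_norm_le (c := 0) zero_lt_one
      (f := fun s => eval ![x + s * c, conj x + s * d] (kernelPoly n k m y))
      (C := 2 * n * ((‖y‖ * (‖x‖ + 1)) ^ m / m.factorial))
      (Differentiable.diffContOnCl fun s => (hder s).differentiableAt) (fun s hs => by
        refine (norm_eval_kernelPoly_le hγ m y _ _).trans ?_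
        have hs1 : ‖s‖ = 1 := by simpa using hs
        have h1 : ‖x + s * c‖ ≤ ‖x‖ + 1 := (norm_add_le _ _).trans (by
          rw [norm_mul, hs1, one_mul]; linarith)
        have h2 : ‖conj x + s * d‖ ≤ ‖x‖ + 1 := (norm_add_le _ _).trans (by
          rw [norm_mul, hs1, one_mul, RCLike.norm_conj]; linarith)
        have h3 : ‖y‖ * (‖x + s * c‖ + ‖conj x + s * d‖) / 2 ≤ ‖y‖ * (‖x‖ + 1) := by
          have := mul_le_mul_of_nonneg_left (add_le_add h1 h2) (norm_nonneg y)
          linarith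
        gcongr)
    rw [(hder 0).deriv, div_one] at h
    simpa [cpxEval] using h
  fin_cases i
  · simpa using key 1 0 (by simp) (by simp)
  · simpa using key 0 1 (by simp) (by simp)

lemma norm_wirtinger_le (a b : ℂ) : ‖wirtinger a b‖ ≤ ‖a‖ + ‖b‖ := by
  refine ContinuousLinearMap.opNorm_le_bound _ (by positivity) fun ξ => ?_
  rw [wirtinger_apply]
  refine (norm_add_le _ _).trans ?_
  rw [norm_mul, norm_mul, RCLike.norm_conj, add_mul]

/-- The series `∑ E_m(x, y)`. -/
def kernelSeries (n : ℕ) (k : ℂ) (y x : ℂ) : ℂ := ∑' m, cpxEval (kernelPoly n k m y) x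

lemma summable_kernelPoly {n : ℕ} [NeZero n] {k : ℂ} (hγ : 0 < (gam n k).re) (y x : ℂ) :
    Summable fun m => cpxEval (kernelPoly n k m y) x :=
  Summable.of_norm_bounded ((Real.summable_pow_div_factorial _).mul_left _)
    fun m => norm_cpxEval_kernelPoly_le hγ m y x

/-- The derivative of `E_m(·, y)`. -/
def kernelDeriv (n : ℕ) (k : ℂ) (y : ℂ) (m : ℕ) (x : ℂ) : ℂ →L[ℝ] ℂ :=
  wirtinger (cpxEval (pderiv 0 (kernelPoly n k m y)) x) (cpxEval (pderiv 1 (kernelPoly n k m y)) x)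

lemma norm_kernelDeriv_le {n : ℕ} [NeZero n] {k : ℂ} (hγ : 0 < (gam n k).re) (y : ℂ) (m : ℕ)
    {x : ℂ} {r : ℝ} (hx : x ∈ Metric.ball (0 : ℂ) r) :
    ‖kernelDeriv n k y m x‖ ≤ 4 * n * ((‖y‖ * (r + 1)) ^ m / m.factorial) := by
  have hx' : ‖x‖ ≤ r := by simpa using (Metric.mem_ball.1 hx).le
  have h : 2 * n * ((‖y‖ * (‖x‖ + 1)) ^ m / m.factorial) ≤
      2 * n * ((‖y‖ * (r + 1)) ^ m / m.factorial) := by gcongr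
  refine (norm_wirtinger_le _ _).trans ?_
  have h0 := norm_cpxEval_pderiv_kernelPoly_le hγ m y x 0
  have h1 := norm_cpxEval_pderiv_kernelPoly_le hγ m y x 1
  linarith

lemma summable_bound (c r : ℝ) : Summable fun m : ℕ => c * (r ^ m / m.factorial) :=
  (Real.summable_pow_div_factorial _).mul_left _

/-- The derivatives are dominated, uniformly on a ball around `0` containing `x`, by a convergent
exponential series. -/
lemma hasFDerivAt_kernelSeries {n : ℕ} [NeZero n] {k : ℂ} (hγ : 0 < (gam n k).re) (y x : ℂ) :
    HasFDerivAt (kernelSeries n k y) (∑' m, kernelDeriv n k y m x) x :=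
  hasFDerivAt_tsum_of_isPreconnected (summable_bound (4 * n) (‖y‖ * (‖x‖ + 1 + 1)))
    (Metric.isOpen_ball (x := 0) (ε := ‖x‖ + 1))
    (convex_ball _ _).isPreconnected (fun m z _ => hasFDerivAt_cpxEval _ z)
    (fun m z hz => norm_kernelDeriv_le hγ y m hz) (Metric.mem_ball_self (by positivity))
    (summable_kernelPoly hγ y 0) (by simp)

lemma continuous_cpxEval (q : Poly) : Continuous (cpxEval q) :=
  continuous_iff_continuousAt.2 fun x => (hasFDerivAt_cpxEval q x).continuousAt

lemma continuous_kernelDeriv (n : ℕ) (k y : ℂ) (m : ℕ) : Continuous (kernelDeriv n k y m) := by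
  have h0 := continuous_cpxEval (pderiv 0 (kernelPoly n k m y))
  have h1 := continuous_cpxEval (pderiv 1 (kernelPoly n k m y))
  exact (h0.smul continuous_const).add (h1.smul continuous_const)

lemma contDiff_kernelSeries {n : ℕ} [NeZero n] {k : ℂ} (hγ : 0 < (gam n k).re) (y : ℂ) :
    ContDiff ℝ 1 (kernelSeries n k y) := by
  refine contDiff_one_iff_fderiv.2
    ⟨fun x => (hasFDerivAt_kernelSeries hγ y x).differentiableAt, ?_⟩
  have h : fderiv ℝ (kernelSeries n k y) = fun x => ∑' m, kernelDeriv n k y m x :=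
    funext fun x => (hasFDerivAt_kernelSeries hγ y x).fderiv
  rw [h, continuous_iff_continuousAt]
  intro x
  refine (continuousOn_tsum (s := Metric.ball 0 (‖x‖ + 1))
    (fun m => (continuous_kernelDeriv n k y m).continuousOn)
    (summable_bound (4 * n) (‖y‖ * (‖x‖ + 1 + 1)))
    fun m z hz => norm_kernelDeriv_le hγ y m hz).continuousAt ?_
  exact Metric.isOpen_ball.mem_nhds (by simp)

lemma isDunklKernel_kernelSeries {n : ℕ} [NeZero n] {k : ℂ} (hγ : 0 < (gam n k).re) (y : ℂ) :
    IsDunklKernel n k y (kernelSeries n k y) := by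
  refine ⟨contDiff_kernelSeries hγ y, ?_, fun ξ x => ?_⟩
  · rw [kernelSeries, tsum_eq_single 0]
    · simp [kernelPoly_zero hγ, cpxEval]
    · intro m hm
      have h := norm_cpxEval_kernelPoly_le hγ m y 0
      simpa [hm] using h
  have hs : ∀ z, HasSum (fun m => cpxEval (kernelPoly n k m y) z) (kernelSeries n k y z) :=
    fun z => (summable_kernelPoly hγ y z).hasSum
  have hd : ∀ ζ, HasSum (fun m => fderiv ℝ (cpxEval (kernelPoly n k m y)) x ζ)
      (fderiv ℝ (kernelSeries n k y) x ζ) := by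
    intro ζ
    have h1 : Summable fun m => kernelDeriv n k y m x :=
      Summable.of_norm_bounded (summable_bound (4 * n) (‖y‖ * (‖x‖ + 1 + 1)))
        fun m => norm_kernelDeriv_le hγ y m (r := ‖x‖ + 1) (by simp)
    have h2 := h1.hasSum.mapL (ContinuousLinearMap.apply ℝ ℂ ζ)
    rw [(hasFDerivAt_kernelSeries hγ y x).fderiv]
    simp only [(hasFDerivAt_cpxEval _ x).fderiv]
    exact h2
  have h1 : HasSum (fun m => dunklOp n k ξ (cpxEval (kernelPoly n k m y)) x)
      (dunklOp n k ξ (kernelSeries n k y) x) := by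
    refine (hd ξ).add (hasSum_sum fun j _ => HasSum.mul_left _ ?_)
    split_ifs
    · exact (hd _).mul_left _
    · exact ((hs _).sub (hs _)).div_const _
  have h2 : HasSum (fun m => dunklOp n k ξ (cpxEval (kernelPoly n k m y)) x)
      ((⟪ξ, y⟫_ℝ : ℂ) * kernelSeries n k y x) := by
    -- The index shift matches `T_ξ E_{m+1} = ⟨ξ, y⟩ E_m`; the extra first term is `T_ξ 1 = 0`.
    rw [← hasSum_nat_add_iff' 1]
    have e0 : dunklOp n k ξ (cpxEval (kernelPoly n k 0 y)) x = 0 := by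
      rw [dunklOp_cpxEval, kernelPoly_zero hγ]
      have h3 : ∀ j, divDiff n j 1 = 0 := fun j => by simpa using divDiff_C n j 1
      simp [dunkl₀, dunkl₁, h3, cpxEval]
    rw [Finset.sum_range_one, e0, sub_zero]
    convert! (hs x).mul_left (⟪ξ, y⟫_ℝ : ℂ) using 2 with m
    rw [dunklOp_cpxEval, dunkl_kernelPoly_succ hγ, cpxEval, smul_eval, cpxEval]
  exact h1.unique h2

lemma existsUnique_isDunklKernel {n : ℕ} [NeZero n] {k : ℂ} (hγ : 0 < (gam n k).re) (y : ℂ) :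
    ∃! f, IsDunklKernel n k y f :=
  ⟨_, isDunklKernel_kernelSeries hγ y, fun _ hf => hf.unique hγ (isDunklKernel_kernelSeries hγ y)⟩

lemma hasSum_dunklKernel {n : ℕ} [NeZero n] {k : ℂ} (hγ : 0 < (gam n k).re) (x y : ℂ) :
    HasSum (fun m => dunklE n k m x y) (dunklKernel n k x y) := by
  have h : Classical.epsilon (IsDunklKernel n k y) = kernelSeries n k y :=
    (Classical.epsilon_spec (existsUnique_isDunklKernel hγ y).exists).unique hγ
      (isDunklKernel_kernelSeries hγ y)
  rw [dunklKernel, h]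
  simpa only [kernelSeries, cpxEval_kernelPoly] using (summable_kernelPoly hγ y x).hasSum

/-! ### The coefficients of the generating function -/

/-- The coefficients of `(γ / 2 n) Φ`, where `Φ = Q₁ - Q₂`. -/
def coeffRot (n : ℕ) (k x y : ℂ) (p : ℕ) : ℂ :=
  gam n k / (2 * n) * (vecA n k x y p 0 - vecA n k x y p 1)

/-- The coefficients of the analogue of `(γ / 2 n) Φ` for the reflections. -/
def coeffRefl (n : ℕ) (k x y : ℂ) (p : ℕ) : ℂ :=
  gam n k / (2 * n) * (vecA n k x y p 0 + vecA n k x y p 1)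

lemma vecA_succ (n : ℕ) (k x y : ℂ) (p : ℕ) :
    vecA n k x y (p + 1) =
      ![1 / ((p : ℂ) + 1) * (gam n k / (2 * n) * ∑ i ∈ Finset.range (p + 1),
          ((rotSum n (p - i + 1) x y + reflSum n (p - i + 1) x y) * vecA n k x y i 0 -
            (rotSum n (p - i + 1) x y - reflSum n (p - i + 1) x y) * vecA n k x y i 1)),
        1 / ((p : ℂ) + 1 + 2 * gam n k) * (gam n k / (2 * n) * ∑ i ∈ Finset.range (p + 1),
          ((rotSum n (p - i + 1) x y - reflSum n (p - i + 1) x y) * vecA n k x y i 0 -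
            (rotSum n (p - i + 1) x y + reflSum n (p - i + 1) x y) * vecA n k x y i 1))] := by
  rw [vecA]
  funext s
  rw [Matrix.mulVec_diagonal, Finset.sum_apply, Finset.sum_range, Finset.sum_range]
  fin_cases s
  · simp only [matB, Fin.zero_eta, Matrix.cons_val_zero, Finset.mul_sum]
    refine Finset.sum_congr rfl fun i _ => ?_
    simp [Matrix.mulVec, dotProduct, Fin.sum_univ_two]
    left
    ring
  · simp only [matB, Fin.mk_one, Matrix.cons_val_one, Matrix.cons_val_fin_one, Finset.mul_sum]
    refine Finset.sum_congr rfl fun i _ => ?_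
    simp [Matrix.mulVec, dotProduct, Fin.sum_univ_two]
    left
    ring

lemma natCast_ne_zero' (n : ℕ) [NeZero n] : (n : ℂ) ≠ 0 := Nat.cast_ne_zero.2 (NeZero.ne n)

lemma gam_ne_zero {n : ℕ} {k : ℂ} (hγ : 0 < (gam n k).re) : gam n k ≠ 0 := by
  simpa using gam_add_ne_zero hγ (m := 0) le_rfl

lemma coeff_zero {n : ℕ} [NeZero n] {k : ℂ} (hγ : 0 < (gam n k).re) (x y : ℂ) :
    coeffRot n k x y 0 = 1 ∧ coeffRefl n k x y 0 = 1 := by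
  have h1 := natCast_ne_zero' n
  have h2 := gam_ne_zero hγ
  constructor
  · simp only [coeffRot, vecA, Matrix.cons_val_zero, Matrix.cons_val_one]
    field_simp
    simp
  · simp only [coeffRefl, vecA, Matrix.cons_val_zero, Matrix.cons_val_one]
    field_simp
    simp

/-- The vector recursion with weights `p` and `p + 2γ` is equivalent, after passing to `A₁ ∓ A₂`, to
two coupled convolution equations, one for rotations and one for reflections. This is the radial
recursion written for coefficients. -/
lemma coeff_recursion {n : ℕ} [NeZero n] {k : ℂ} (hγ : 0 < (gam n k).re) (x y : ℂ) (m : ℕ) :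
    ((m : ℂ) + gam n k) * coeffRot n k x y m =
        k * ∑ i ∈ Finset.range (m + 1), coeffRefl n k x y i * reflSum n (m - i) x y ∧
      ((m : ℂ) + gam n k) * coeffRefl n k x y m =
        k * ∑ i ∈ Finset.range (m + 1), coeffRot n k x y i * rotSum n (m - i) x y := by
  have hn := natCast_ne_zero' n
  have hk : k = 2 * (gam n k / (2 * n)) := by
    rw [gam]; field_simp
  have hr : rotSum n 0 x y = n := by simp [rotSum]
  have hf : reflSum n 0 x y = n := by simp [reflSum]
  have hkn : k * n = gam n k := mul_comm _ _
  rcases m with _ | p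
  · simp [coeff_zero hγ, hr, hf, hkn]
  set c := gam n k / (2 * n) with hc
  have h1 : ((p : ℂ) + 1) ≠ 0 := Nat.cast_add_one_ne_zero p
  have h2 : (p : ℂ) + 1 + 2 * gam n k ≠ 0 := by
    simpa using two_gam_add_ne_zero hγ (m := p + 1) (by positivity)
  have e := vecA_succ n k x y p
  have e0 : ((p : ℂ) + 1) * vecA n k x y (p + 1) 0 = c * ∑ i ∈ Finset.range (p + 1),
          ((rotSum n (p - i + 1) x y + reflSum n (p - i + 1) x y) * vecA n k x y i 0 -
            (rotSum n (p - i + 1) x y - reflSum n (p - i + 1) x y) * vecA n k x y i 1) := by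
    rw [e, Matrix.cons_val_zero, ← mul_assoc, mul_one_div_cancel h1, one_mul]
  have e1 : ((p : ℂ) + 1 + 2 * gam n k) * vecA n k x y (p + 1) 1 =
      c * ∑ i ∈ Finset.range (p + 1),
          ((rotSum n (p - i + 1) x y - reflSum n (p - i + 1) x y) * vecA n k x y i 0 -
            (rotSum n (p - i + 1) x y + reflSum n (p - i + 1) x y) * vecA n k x y i 1) := by
    rw [e, Matrix.cons_val_one, Matrix.cons_val_zero, ← mul_assoc, mul_one_div_cancel h2, one_mul]
  have hsub : ∀ i ∈ Finset.range (p + 1), p + 1 - i = p - i + 1 := fun i hi =>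
    Nat.succ_sub (Nat.lt_succ_iff.1 (Finset.mem_range.1 hi))
  have f1 : ∑ i ∈ Finset.range (p + 1), coeffRefl n k x y i * reflSum n (p + 1 - i) x y =
      ∑ i ∈ Finset.range (p + 1), coeffRefl n k x y i * reflSum n (p - i + 1) x y :=
    Finset.sum_congr rfl fun i hi => by rw [hsub i hi]
  have f2 : ∑ i ∈ Finset.range (p + 1), coeffRot n k x y i * rotSum n (p + 1 - i) x y =
      ∑ i ∈ Finset.range (p + 1), coeffRot n k x y i * rotSum n (p - i + 1) x y :=
    Finset.sum_congr rfl fun i hi => by rw [hsub i hi]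
  have g1 : 2 * ∑ i ∈ Finset.range (p + 1), coeffRefl n k x y i * reflSum n (p - i + 1) x y =
      ((p : ℂ) + 1) * vecA n k x y (p + 1) 0 -
        ((p : ℂ) + 1 + 2 * gam n k) * vecA n k x y (p + 1) 1 := by
    rw [e0, e1, ← mul_sub, ← Finset.sum_sub_distrib, Finset.mul_sum, Finset.mul_sum]
    refine Finset.sum_congr rfl fun i _ => ?_
    rw [coeffRefl]
    ring
  have g2 : 2 * ∑ i ∈ Finset.range (p + 1), coeffRot n k x y i * rotSum n (p - i + 1) x y =
      ((p : ℂ) + 1) * vecA n k x y (p + 1) 0 +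
        ((p : ℂ) + 1 + 2 * gam n k) * vecA n k x y (p + 1) 1 := by
    rw [e0, e1, ← mul_add, ← Finset.sum_add_distrib, Finset.mul_sum, Finset.mul_sum]
    refine Finset.sum_congr rfl fun i _ => ?_
    rw [coeffRot]
    ring
  -- The last term of each convolution has weight `k n = γ` and still involves the unknown
  -- coefficient of index `p + 1`.
  rw [Finset.sum_range_succ _ (p + 1), Finset.sum_range_succ _ (p + 1), f1, f2, Nat.sub_self, hr, hf]
  generalize ∑ i ∈ Finset.range (p + 1), coeffRot n k x y i * rotSum n (p - i + 1) x y = s1 at *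
  generalize ∑ i ∈ Finset.range (p + 1), coeffRefl n k x y i * reflSum n (p - i + 1) x y = s2 at *
  have hk1 : k * s1 = c * (2 * s1) := by
    conv_lhs => rw [hk]
    ring
  have hk2 : k * s2 = c * (2 * s2) := by
    conv_lhs => rw [hk]
    ring
  have hR : coeffRot n k x y (p + 1) =
    c * (vecA n k x y (p + 1) 0 - vecA n k x y (p + 1) 1) := rfl
  have hF : coeffRefl n k x y (p + 1) =
    c * (vecA n k x y (p + 1) 0 + vecA n k x y (p + 1) 1) := rfl
  push_cast
  constructor
  · rw [mul_add, hk2, g1, mul_left_comm k, hkn, hR, hF]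
    ring
  · rw [mul_add, hk1, g2, mul_left_comm k, hkn, hR, hF]
    ring

/-! ### The components `E_m` on an orbit as convolutions. -/

lemma dunklE_recursion {n : ℕ} [NeZero n] {k : ℂ} (hγ : 0 < (gam n k).re) (m : ℕ) (z y : ℂ) :
    (((m + 1 : ℕ) : ℂ) + gam n k) * dunklE n k (m + 1) z y -
        k * ∑ j, dunklE n k (m + 1) (omega n j * conj z) y =
      (⟪z, y⟫_ℝ : ℂ) * dunklE n k m z y := by
  have h := eval_kernelPoly_recursion hγ m y z (conj z)
  simp only [← cpxEval_kernelPoly, cpxEval, map_mul, conj_omega, Complex.conj_conj] at h ⊢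
  rw [h, ofReal_inner]
  ring

lemma dunklE_zero {n : ℕ} [NeZero n] {k : ℂ} (hγ : 0 < (gam n k).re) (x y : ℂ) :
    dunklE n k 0 x y = 1 := by
  rw [← cpxEval_kernelPoly, kernelPoly_zero hγ]
  simp [cpxEval]

lemma pochhammer_ne_zero {n : ℕ} {k : ℂ} (hγ : 0 < (gam n k).re) (m : ℕ) :
    (ascPochhammer ℂ m).eval (1 + gam n k) ≠ 0 := by
  induction m with
  | zero => simp
  | succ m ih =>
    rw [ascPochhammer_succ_eval]
    refine mul_ne_zero ih ?_
    have := gam_add_ne_zero hγ (m := m + 1) (by positivity)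
    push_cast at this
    rwa [add_comm, ← add_assoc]

/-- Both sides satisfy the same radial recursion on the orbit, so `orbit_unique` identifies them.
Rotations and reflections must be treated together, since the recursion couples the two halves of
the orbit. -/
lemma sum_coeff_eq {n : ℕ} [NeZero n] {k : ℂ} (hγ : 0 < (gam n k).re) (x y : ℂ) (m : ℕ) :
    (fun j => ∑ i ∈ Finset.range (m + 1), coeffRot n k x y i * (⟪rot n j x, y⟫_ℝ : ℂ) ^ (m - i)) =
      (fun j => (ascPochhammer ℂ m).eval (1 + gam n k) * dunklE n k m (rot n j x) y) ∧
    (fun j => ∑ i ∈ Finset.range (m + 1),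
        coeffRefl n k x y i * (⟪rot n j (sigma x), y⟫_ℝ : ℂ) ^ (m - i)) =
      (fun j => (ascPochhammer ℂ m).eval (1 + gam n k) * dunklE n k m (rot n j (sigma x)) y) := by
  induction m with
  | zero => simp [coeff_zero hγ, dunklE_zero hγ]
  | succ m ih =>
    have hsucc : ∀ (f : ℕ → ℂ) (c : ℂ), ∑ i ∈ Finset.range (m + 1 + 1), f i * c ^ (m + 1 - i) =
        c * ∑ i ∈ Finset.range (m + 1), f i * c ^ (m - i) + f (m + 1) := by
      intro f c
      rw [Finset.sum_range_succ, Nat.sub_self, pow_zero, mul_one, Finset.mul_sum]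
      congr 1
      refine Finset.sum_congr rfl fun i hi => ?_
      rw [Nat.succ_sub (Nat.lt_succ_iff.1 (Finset.mem_range.1 hi)), pow_succ]
      ring
    have hrot : ∑ j : Fin n, ∑ i ∈ Finset.range (m + 1 + 1),
        coeffRot n k x y i * (⟪rot n j x, y⟫_ℝ : ℂ) ^ (m + 1 - i) =
        ∑ i ∈ Finset.range (m + 1 + 1), coeffRot n k x y i * rotSum n (m + 1 - i) x y := by
      rw [Finset.sum_comm]
      simp only [rotSum, Finset.mul_sum]
    have hrefl : ∑ j : Fin n, ∑ i ∈ Finset.range (m + 1 + 1),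
        coeffRefl n k x y i * (⟪rot n j (sigma x), y⟫_ℝ : ℂ) ^ (m + 1 - i) =
        ∑ i ∈ Finset.range (m + 1 + 1), coeffRefl n k x y i * reflSum n (m + 1 - i) x y := by
      rw [Finset.sum_comm]
      simp only [reflSum, Finset.mul_sum]
    have hc := coeff_recursion hγ x y (m + 1)
    set P := (ascPochhammer ℂ m).eval (1 + gam n k) with hP
    have hPs : (ascPochhammer ℂ (m + 1)).eval (1 + gam n k) =
        P * (((m + 1 : ℕ) : ℂ) + gam n k) := by
      rw [ascPochhammer_succ_eval]
      push_cast
      ring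
    refine orbit_unique hγ.le _ _ _ _ (m := ((m + 1 : ℕ) : ℝ)) (by positivity)
      (fun j => ?_) (fun j => ?_)
    · have h1 := congrFun ih.1 j
      have h2 := dunklE_recursion hγ m (rot n j x) y
      have h3 : ∑ i, dunklE n k (m + 1) (omega n i * conj (rot n j x)) y =
          ∑ i, dunklE n k (m + 1) (rot n i (sigma x)) y :=
        sum_omega_mul_conj n (fun z => dunklE n k (m + 1) z y) j x
      simp only [hrefl, ← hc.1, Complex.ofReal_natCast, ← Finset.mul_sum, hPs]
      simp only [hsucc]
      rw [h3] at h2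
      rw [h1]
      linear_combination (-P * (((m + 1 : ℕ) : ℂ) + gam n k)) * h2
    · have h1 := congrFun ih.2 j
      have h2 := dunklE_recursion hγ m (rot n j (sigma x)) y
      have h3 : ∑ i, dunklE n k (m + 1) (omega n i * conj (rot n j (sigma x))) y =
          ∑ i, dunklE n k (m + 1) (rot n i x) y := by
        have := sum_omega_mul_conj n (fun z => dunklE n k (m + 1) z y) j (sigma x)
        rwa [sigma, Complex.conj_conj] at this
      simp only [hrot, ← hc.2, Complex.ofReal_natCast, ← Finset.mul_sum, hPs]
      simp only [hsucc]
      rw [h3] at h2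
      rw [h1]
      linear_combination (-P * (((m + 1 : ℕ) : ℂ) + gam n k)) * h2

lemma pochhammer_mul_dunklE {n : ℕ} [NeZero n] {k : ℂ} (hγ : 0 < (gam n k).re) (x y : ℂ) (m : ℕ) :
    (ascPochhammer ℂ m).eval (1 + gam n k) * dunklE n k m x y =
      ∑ i ∈ Finset.range (m + 1), coeffRot n k x y i * (⟪x, y⟫_ℝ : ℂ) ^ (m - i) := by
  have h := congrFun (sum_coeff_eq hγ x y m).1 0
  simp only [rot_eq, omega_zero, one_mul] at h
  exact h.symm

/-! ### Bounds for the coefficients -/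

lemma abs_inner_rot_le (n : ℕ) (x y : ℂ) (j : Fin n) :
    |⟪rot n j x, y⟫_ℝ| ≤ a n x y ∧ |⟪rot n j (sigma x), y⟫_ℝ| ≤ a n x y := by
  have h : max |⟪rot n j x, y⟫_ℝ| |⟪rot n j (sigma x), y⟫_ℝ| ≤ a n x y :=
    le_ciSup (f := fun j : Fin n => max |⟪rot n j x, y⟫_ℝ| |⟪rot n j (sigma x), y⟫_ℝ|)
      (Set.finite_range _).bddAbove j
  exact ⟨(le_max_left _ _).trans h, (le_max_right _ _).trans h⟩

lemma abs_inner_le (n : ℕ) [NeZero n] (x y : ℂ) : |⟪x, y⟫_ℝ| ≤ a n x y := by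
  simpa [rot_eq, omega_zero] using (abs_inner_rot_le n x y 0).1

lemma a_nonneg (n : ℕ) [NeZero n] (x y : ℂ) : 0 ≤ a n x y :=
  (abs_nonneg _).trans (abs_inner_le n x y)

lemma norm_rotSum_le (n : ℕ) (p : ℕ) (x y : ℂ) :
    ‖rotSum n p x y‖ ≤ n * a n x y ^ p ∧ ‖reflSum n p x y‖ ≤ n * a n x y ^ p := by
  have h : ∀ f : Fin n → ℝ, (∀ j, |f j| ≤ a n x y) →
      ‖∑ j, ((f j : ℝ) : ℂ) ^ p‖ ≤ n * a n x y ^ p := by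
    intro f hf
    refine (norm_sum_le _ _).trans ?_
    refine (Finset.sum_le_card_nsmul _ _ (a n x y ^ p) fun j _ => ?_).trans ?_
    · rw [norm_pow, Complex.norm_real, Real.norm_eq_abs]
      exact pow_le_pow_left₀ (abs_nonneg _) (hf j) p
    · simp
  exact ⟨h _ fun j => (abs_inner_rot_le n x y j).1, h _ fun j => (abs_inner_rot_le n x y j).2⟩

/-- Strong induction: the `p + 1` terms of the recursion have a common bound, and the divisors `p +
1` and `p + 1 + 2γ`, both of modulus at least `p + 1`, absorb their number. -/
lemma norm_vecA_le {n : ℕ} [NeZero n] {k : ℂ} (hγ : 0 < (gam n k).re) (x y : ℂ) (p : ℕ) :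
    ∀ s, ‖vecA n k x y p s‖ ≤
      ‖2 * n / gam n k‖ * ((1 + 2 * ‖gam n k‖) * a n x y) ^ p := by
  set C₀ := ‖2 * n / gam n k‖
  set K := 2 * ‖gam n k‖ with hK
  set α := a n x y with hα
  have hα0 : 0 ≤ α := a_nonneg n x y
  have hC0 : 0 ≤ C₀ := norm_nonneg _
  have hK0 : 0 ≤ K := by positivity
  induction p using Nat.strong_induction_on with
  | _ p ih =>
  rcases p with _ | p
  · intro s
    fin_cases s
    · simp [vecA, C₀]
    · simp [vecA]
      positivity
  have hn : (0 : ℝ) < n := Nat.cast_pos.2 (Nat.pos_of_ne_zero (NeZero.ne n))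
  -- The signs `e, e' = ±1` treat both rows of `B_p` at once.
  have hterm : ∀ (e : ℂ) (e' : ℂ), ‖e‖ ≤ 1 → ‖e'‖ ≤ 1 →
      ‖gam n k / (2 * n) * ∑ i ∈ Finset.range (p + 1),
          ((rotSum n (p - i + 1) x y + e * reflSum n (p - i + 1) x y) * vecA n k x y i 0 -
            (rotSum n (p - i + 1) x y + e' * reflSum n (p - i + 1) x y) * vecA n k x y i 1)‖ ≤
        ((p : ℝ) + 1) * (C₀ * ((1 + K) * α) ^ (p + 1)) := by
    intro e e' he he'
    have hsum : ∀ i ∈ Finset.range (p + 1),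
        ‖(rotSum n (p - i + 1) x y + e * reflSum n (p - i + 1) x y) * vecA n k x y i 0 -
            (rotSum n (p - i + 1) x y + e' * reflSum n (p - i + 1) x y) * vecA n k x y i 1‖ ≤
        4 * n * (C₀ * (1 + K) ^ p * α ^ (p + 1)) := by
      intro i hi
      have hi' : i ≤ p := Nat.lt_succ_iff.1 (Finset.mem_range.1 hi)
      have h1 := norm_rotSum_le n (p - i + 1) x y
      have h2 : ∀ d : ℂ, ‖d‖ ≤ 1 →
          ‖rotSum n (p - i + 1) x y + d * reflSum n (p - i + 1) x y‖ ≤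
            2 * n * α ^ (p - i + 1) := by
        intro d hd
        refine (norm_add_le _ _).trans ?_
        rw [norm_mul]
        have := mul_le_mul hd h1.2 (norm_nonneg _) zero_le_one
        linarith [h1.1]
      have h3 : ∀ d : ℂ, ‖d‖ ≤ 1 → ∀ s,
          ‖(rotSum n (p - i + 1) x y + d * reflSum n (p - i + 1) x y) * vecA n k x y i s‖ ≤
            2 * n * (C₀ * (1 + K) ^ p * α ^ (p + 1)) := by
        intro d hd s
        rw [norm_mul]
        have h4 := mul_le_mul (h2 d hd) (ih i (Nat.lt_succ_of_le hi') s) (norm_nonneg _)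
          (by positivity)
        refine h4.trans ?_
        have h5 : α ^ (p + 1) = α ^ (p - i + 1) * α ^ i := by
          rw [← pow_add]; congr 1; omega
        have h6 : (1 + K) ^ i ≤ (1 + K) ^ p := pow_le_pow_right₀ (by linarith) hi'
        rw [mul_pow, h5]
        calc 2 * n * α ^ (p - i + 1) * (C₀ * ((1 + K) ^ i * α ^ i))
            = 2 * n * (C₀ * (1 + K) ^ i * (α ^ (p - i + 1) * α ^ i)) := by ring
          _ ≤ _ := by gcongr
      refine (norm_sub_le _ _).trans ?_
      linarith [h3 e he 0, h3 e' he' 1]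
    rw [norm_mul]
    have h7 := (norm_sum_le _ _).trans (Finset.sum_le_card_nsmul _ _ _ hsum)
    rw [Finset.card_range, nsmul_eq_mul] at h7
    have h8 : ‖gam n k / (2 * n)‖ = K / (4 * n) := by
      rw [norm_div, norm_mul, Complex.norm_ofNat, Complex.norm_natCast, hK]
      field_simp
      norm_num
    rw [h8]
    refine (mul_le_mul_of_nonneg_left h7 (by positivity)).trans ?_
    have h9 : K / (4 * n) * (((p + 1 : ℕ) : ℝ) * (4 * n * (C₀ * (1 + K) ^ p * α ^ (p + 1)))) =
        ((p : ℝ) + 1) * (C₀ * ((K * (1 + K) ^ p) * α ^ (p + 1))) := by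
      push_cast
      field_simp
    rw [h9, mul_pow]
    -- The growth rate `1 + K` is chosen so that the factor `K` from `γ / 2n` is absorbed by one
    -- more power.
    have h10 : K * (1 + K) ^ p ≤ (1 + K) ^ (p + 1) := by
      rw [pow_succ, mul_comm]
      exact mul_le_mul_of_nonneg_left (by linarith) (by positivity)
    gcongr
  have hp : (0 : ℝ) < (p : ℝ) + 1 := by positivity
  have hfin : ∀ d S : ℂ, (p : ℝ) + 1 ≤ ‖d‖ →
      ‖S‖ ≤ ((p : ℝ) + 1) * (C₀ * ((1 + K) * α) ^ (p + 1)) →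
      ‖1 / d * S‖ ≤ C₀ * ((1 + K) * α) ^ (p + 1) := by
    intro d S hd hS
    rw [norm_mul, norm_div, norm_one, one_div_mul_eq_div, div_le_iff₀ (hp.trans_le hd), mul_comm]
    exact hS.trans (mul_le_mul_of_nonneg_right hd (by positivity))
  intro s
  rw [vecA_succ]
  fin_cases s
  · refine hfin _ _ ?_ ?_
    · have := Complex.norm_natCast (p + 1)
      push_cast at this
      exact this.ge
    · simpa [sub_eq_add_neg] using hterm 1 (-1) (by simp) (by simp)
  · refine hfin _ _ ?_ ?_
    · refine le_trans ?_ (Complex.re_le_norm _)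
      simp
      exact hγ.le
    · simpa [sub_eq_add_neg] using hterm (-1) 1 (by simp) (by simp)

/-! ### Power series on circles -/

lemma summable_conv {φ : ℕ → ℂ} {s : ℂ} {ρ : ℝ} (hρ : 0 ≤ ρ)
    (hφ : Summable fun p => ‖φ p‖ * ρ ^ p) (hs : ρ * ‖s‖ < 1) :
    Summable fun m => ‖∑ i ∈ Finset.range (m + 1), φ i * s ^ (m - i)‖ * ρ ^ m := by
  have h1 : Summable fun p => ‖φ p * (ρ : ℂ) ^ p‖ := by
    simpa [norm_mul, norm_pow, abs_of_nonneg hρ] using hφ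
  have h2 : Summable fun p => ‖((ρ : ℂ) * s) ^ p‖ := by
    simp only [norm_pow, norm_mul, Complex.norm_real, Real.norm_eq_abs, abs_of_nonneg hρ]
    exact summable_geometric_of_lt_one (by positivity) hs
  refine (summable_norm_sum_mul_range_of_summable_norm h1 h2).congr fun m => ?_
  have : ∑ i ∈ Finset.range (m + 1), φ i * (ρ : ℂ) ^ i * ((ρ : ℂ) * s) ^ (m - i) =
      (∑ i ∈ Finset.range (m + 1), φ i * s ^ (m - i)) * (ρ : ℂ) ^ m := by
    rw [Finset.sum_mul]
    refine Finset.sum_congr rfl fun i hi => ?_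
    rw [← pow_mul_pow_sub (ρ : ℂ) (Nat.lt_succ_iff.1 (Finset.mem_range.1 hi)), mul_pow]
    ring
  rw [this, norm_mul, norm_pow, Complex.norm_real, Real.norm_eq_abs, abs_of_nonneg hρ]

lemma hasSum_conv {φ : ℕ → ℂ} {s z S : ℂ} {ρ : ℝ} (hz : ‖z‖ = ρ)
    (hφ : Summable fun p => ‖φ p‖ * ρ ^ p) (hs : ρ * ‖s‖ < 1)
    (hS : HasSum (fun p => φ p * z ^ p) S) :
    HasSum (fun m => (∑ i ∈ Finset.range (m + 1), φ i * s ^ (m - i)) * z ^ m)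
      (S / (1 - z * s)) := by
  have h1 : Summable fun p => ‖φ p * z ^ p‖ := by
    simpa [norm_mul, norm_pow, hz] using hφ
  have hzs : ‖z * s‖ < 1 := by rwa [norm_mul, hz]
  have h2 : Summable fun p => ‖(z * s) ^ p‖ := by
    simp only [norm_pow]
    exact summable_geometric_of_lt_one (norm_nonneg _) hzs
  have hm : ∀ m, ∑ i ∈ Finset.range (m + 1), φ i * z ^ i * (z * s) ^ (m - i) =
      (∑ i ∈ Finset.range (m + 1), φ i * s ^ (m - i)) * z ^ m := by
    intro m
    rw [Finset.sum_mul]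
    refine Finset.sum_congr rfl fun i hi => ?_
    rw [← pow_mul_pow_sub z (Nat.lt_succ_iff.1 (Finset.mem_range.1 hi)), mul_pow]
    ring
  have h3 := (summable_norm_sum_mul_range_of_summable_norm h1 h2).of_norm.hasSum
  rw [← tsum_mul_tsum_eq_tsum_sum_range_of_summable_norm h1 h2, hS.tsum_eq,
    tsum_geometric_of_norm_lt_one hzs, ← div_eq_mul_inv] at h3
  simpa only [hm] using h3

/-- Termwise integration along a circle. -/
lemma hasSum_circleIntegral {F : ℕ → ℂ → ℂ} {f : ℂ → ℂ} {u : ℕ → ℝ} {ρ : ℝ} (hρ : 0 ≤ ρ)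
    (hF : ∀ i, ContinuousOn (F i) (Metric.sphere 0 ρ)) (hu : Summable u)
    (hFu : ∀ i, ∀ z ∈ Metric.sphere (0 : ℂ) ρ, ‖F i z‖ ≤ u i)
    (hf : ∀ z ∈ Metric.sphere (0 : ℂ) ρ, HasSum (fun i => F i z) (f z)) :
    HasSum (fun i => ∮ z in C(0, ρ), F i z) (∮ z in C(0, ρ), f z) := by
  have hmem : ∀ θ, circleMap 0 ρ θ ∈ Metric.sphere (0 : ℂ) ρ := circleMap_mem_sphere 0 hρ
  refine intervalIntegral.hasSum_integral_of_dominated_convergence (fun i _ => ρ * u i)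
    (fun i => ?_) (fun i => ?_) ?_ ?_ ?_
  · have hd : Continuous (deriv (circleMap 0 ρ)) := by
      have : deriv (circleMap 0 ρ) = fun θ => circleMap 0 ρ θ * Complex.I :=
        funext fun θ => deriv_circleMap 0 ρ θ
      rw [this]
      exact (continuous_circleMap 0 ρ).mul continuous_const
    exact (hd.smul ((hF i).comp_continuous (continuous_circleMap 0 ρ)
      hmem)).aestronglyMeasurable
  · refine Filter.Eventually.of_forall fun θ _ => ?_
    rw [norm_smul, deriv_circleMap, norm_mul, norm_circleMap_zero, Complex.norm_I, mul_one,
      abs_of_nonneg hρ]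
    exact mul_le_mul_of_nonneg_left (hFu i _ (hmem θ)) hρ
  · exact Filter.Eventually.of_forall fun θ _ => hu.mul_left ρ
  · exact intervalIntegrable_const
  · exact Filter.Eventually.of_forall fun θ _ => (hf _ (hmem θ)).const_smul _

/-- Only absolute convergence on the circle itself is required: integrating termwise leaves just the
residue term `p = m`. -/
lemma circleIntegral_div_pow {d : ℕ → ℂ} {f : ℂ → ℂ} {ρ : ℝ} (hρ : 0 < ρ)
    (hd : Summable fun p => ‖d p‖ * ρ ^ p)
    (hf : ∀ z ∈ Metric.sphere (0 : ℂ) ρ, HasSum (fun p => d p * z ^ p) (f z)) (m : ℕ) :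
    ∮ z in C(0, ρ), f z / z ^ (m + 1) = 2 * Real.pi * Complex.I * d m := by
  have hz0 : ∀ z ∈ Metric.sphere (0 : ℂ) ρ, z ≠ 0 := fun z hz => Metric.ne_of_mem_sphere hz hρ.ne'
  have h := hasSum_circleIntegral hρ.le (F := fun p z => d p * z ^ p / z ^ (m + 1))
    (f := fun z => f z / z ^ (m + 1)) (u := fun p => ‖d p‖ * ρ ^ p / ρ ^ (m + 1))
    (fun p => ContinuousOn.div (by fun_prop) (by fun_prop) fun z hz => pow_ne_zero _ (hz0 z hz))
    (hd.div_const _)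
    (fun p z hz => by
      rw [norm_div, norm_mul, norm_pow, norm_pow, mem_sphere_zero_iff_norm.1 hz])
    (fun z hz => (hf z hz).div_const _)
  have hint : ∀ p, ∮ z in C(0, ρ), d p * z ^ p / z ^ (m + 1) =
      if p = m then 2 * Real.pi * Complex.I * d m else 0 := by
    intro p
    have e : ∮ z in C(0, ρ), d p * z ^ p / z ^ (m + 1) =
        ∮ z in C(0, ρ), d p • (z - 0) ^ ((p : ℤ) - (m + 1)) := by
      refine circleIntegral.integral_congr hρ.le fun z hz => ?_
      have := hz0 z hz
      simp only [sub_zero, smul_eq_mul]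
      rw [zpow_sub₀ this, zpow_natCast, mul_div_assoc]
      norm_cast
    rw [e, circleIntegral.integral_smul]
    split_ifs with hp
    · have e2 : (p : ℤ) - (m + 1) = -1 := by rw [hp]; ring
      simp only [e2, zpow_neg_one]
      rw [circleIntegral.integral_sub_center_inv 0 hρ.ne', hp, smul_eq_mul, mul_comm]
    · rw [circleIntegral.integral_sub_zpow_of_ne (by omega), smul_zero]
  simp only [hint] at h
  exact h.unique (hasSum_ite_eq m _)

/-! ### The generating function -/

lemma summable_phi {n : ℕ} {k x y : ℂ} {ρ : ℝ} (hρ : 0 ≤ ρ)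
    (h : Summable fun p : ℕ => (ρ : ℂ) ^ (p + 1) • vecA n k x y (p + 1)) :
    Summable fun p => ‖vecA n k x y p 0 - vecA n k x y p 1‖ * ρ ^ p := by
  rw [← summable_nat_add_iff 1]
  have h0 := (Pi.summable.1 h 0).norm
  have h1 := (Pi.summable.1 h 1).norm
  refine Summable.of_nonneg_of_le (fun p => by positivity) (fun p => ?_) (h0.add h1)
  simp only [Pi.smul_apply, smul_eq_mul, norm_mul, norm_pow, Complex.norm_real, Real.norm_eq_abs,
    abs_of_nonneg hρ]
  rw [← mul_add, mul_comm]
  gcongr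
  exact norm_sub_le _ _

lemma hasSum_Phi {n : ℕ} {k x y z : ℂ}
    (h : Summable fun p : ℕ => z ^ (p + 1) • vecA n k x y (p + 1)) :
    HasSum (fun p => (vecA n k x y p 0 - vecA n k x y p 1) * z ^ p) (Phi n k z x y) := by
  have h1 := Pi.hasSum.1 (h.hasSum : HasSum _ (Q n k z x y))
  rw [← hasSum_nat_add_iff' 1]
  have h2 := (h1 0).sub (h1 1)
  convert! h2 using 1
  · funext p
    simp only [Pi.smul_apply, smul_eq_mul]
    ring
  · change _ = Q n k z x y 0 - Q n k z x y 1
    simp [Phi, vecA]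
    ring

/-- A Cauchy product with the geometric series. Since `δ ≥ 1` and `|⟨x, y⟩| ≤ a(x, y)`, that series
converges on the circle. -/
lemma hasSum_Phi_div {n : ℕ} [NeZero n] {k x y : ℂ} {δ ρ : ℝ} (hδ : 1 ≤ δ) (hρ : 0 < ρ)
    (hρa : ρ * (δ * a n x y) < 1)
    (h : ∀ z : ℂ, ‖z‖ * (δ * a n x y) < 1 →
      Summable fun p : ℕ => z ^ (p + 1) • vecA n k x y (p + 1)) :
    (Summable fun m => ‖∑ i ∈ Finset.range (m + 1),
      (vecA n k x y i 0 - vecA n k x y i 1) * (⟪x, y⟫_ℝ : ℂ) ^ (m - i)‖ * ρ ^ m) ∧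
    ∀ z ∈ Metric.sphere (0 : ℂ) ρ, HasSum (fun m => (∑ i ∈ Finset.range (m + 1),
      (vecA n k x y i 0 - vecA n k x y i 1) * (⟪x, y⟫_ℝ : ℂ) ^ (m - i)) * z ^ m)
      (Phi n k z x y / (1 - z * (⟪x, y⟫_ℝ : ℂ))) := by
  have hφ := summable_phi hρ.le (h ρ (by
    rwa [Complex.norm_real, Real.norm_eq_abs, abs_of_pos hρ]))
  have hs : ρ * ‖(⟪x, y⟫_ℝ : ℂ)‖ < 1 := by
    rw [Complex.norm_real, Real.norm_eq_abs]
    refine lt_of_le_of_lt (mul_le_mul_of_nonneg_left ?_ hρ.le) hρa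
    have := abs_inner_le n x y
    nlinarith [a_nonneg n x y]
  refine ⟨summable_conv hρ.le hφ hs, fun z hz => ?_⟩
  have hz' : ‖z‖ = ρ := by simpa using hz
  exact hasSum_conv hz' hφ hs (hasSum_Phi (h z (by rwa [hz'])))

/-- The witness `1 + 2 |γ|` is the growth rate of `A_p` from `norm_vecA_le`; the contour integral
then reads off the convolution coefficient of `pochhammer_mul_dunklE`. -/
lemma admissible_nonempty {n : ℕ} [NeZero n] {k : ℂ} (hγ : 0 < (gam n k).re) :
    (admissible n k).Nonempty := by
  have hδ : 1 ≤ 1 + 2 * ‖gam n k‖ := by linarith [norm_nonneg (gam n k)]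
  refine ⟨1 + 2 * ‖gam n k‖, hδ, fun x y => ?_⟩
  have hsum : ∀ z : ℂ, ‖z‖ * ((1 + 2 * ‖gam n k‖) * a n x y) < 1 →
      Summable fun p : ℕ => z ^ (p + 1) • vecA n k x y (p + 1) := by
    intro z hz
    have ha := a_nonneg n x y
    have hg := ((summable_nat_add_iff 1).2
      (summable_geometric_of_lt_one (by positivity) hz)).mul_left ‖2 * n / gam n k‖
    refine Summable.of_norm_bounded hg fun p => ?_
    rw [norm_smul, norm_pow, mul_pow ‖z‖, mul_left_comm]
    gcongr
    exact (pi_norm_le_iff_of_nonneg (by positivity)).2 (norm_vecA_le hγ x y (p + 1))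
  refine ⟨hsum, fun ρ hρ hρa m => ?_⟩
  have h := hasSum_Phi_div hδ hρ hρa hsum
  rw [circleIntegral_div_pow hρ h.1 h.2]
  have hp := pochhammer_mul_dunklE hγ x y m
  have hP := pochhammer_ne_zero hγ m
  have hpi : (2 * Real.pi * Complex.I : ℂ) ≠ 0 := Complex.two_pi_I_ne_zero
  simp only [coeffRot, mul_assoc (gam n k / (2 * n)), ← Finset.mul_sum] at hp
  rw [← mul_assoc (1 / _), one_div_mul_cancel hpi, one_mul, div_mul_eq_mul_div, eq_div_iff hP,
    ← hp, mul_comm]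

lemma admissible_isUpperSet (n : ℕ) [NeZero n] (k : ℂ) : IsUpperSet (admissible n k) := by
  intro δ δ' hle hδ
  refine ⟨hδ.1.trans hle, fun x y => ?_⟩
  have ha := a_nonneg n x y
  have hlt : ∀ r : ℝ, 0 ≤ r → r * (δ' * a n x y) < 1 → r * (δ * a n x y) < 1 := fun r hr h =>
    lt_of_le_of_lt (by gcongr) h
  exact ⟨fun z hz => (hδ.2 x y).1 z (hlt _ (norm_nonneg z) hz),
    fun ρ hρ h m => (hδ.2 x y).2 ρ hρ (hlt ρ hρ.le h) m⟩

/-! ### The integral representation -/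

/-- This is the Beta value at `(γ, m + 1)`, with `γ (γ + 1) ⋯ (γ + m) = γ (1 + γ)_m`. -/
lemma integral_beta {n : ℕ} {k : ℂ} (hγ : 0 < (gam n k).re) (m : ℕ) :
    ∫ t in (0 : ℝ)..1, (1 - (t : ℂ)) ^ (gam n k - 1) * (t : ℂ) ^ m =
      m.factorial / (gam n k * (ascPochhammer ℂ m).eval (1 + gam n k)) := by
  have hprod : ∏ j ∈ Finset.range (m + 1), (gam n k + j) =
      gam n k * (ascPochhammer ℂ m).eval (1 + gam n k) := by
    induction m with
    | zero => simp
    | succ m ih =>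
      rw [Finset.prod_range_succ, ih, ascPochhammer_succ_eval]
      push_cast
      ring
  have h := Complex.betaIntegral_eval_nat_add_one_right hγ m
  rw [← Complex.betaIntegral_symm, Complex.betaIntegral] at h
  rw [hprod] at h
  rw [← h]
  refine intervalIntegral.integral_congr fun t _ => ?_
  simp [mul_comm]

lemma intervalIntegrable_one_sub_cpow {n : ℕ} {k : ℂ} (hγ : 0 < (gam n k).re) :
    IntervalIntegrable (fun t : ℝ => (1 - (t : ℂ)) ^ (gam n k - 1)) MeasureTheory.volume 0 1 := by
  have h := Complex.betaIntegral_convergent (u := 1) (v := gam n k) (by simp) hγ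
  simpa using h

lemma norm_pow_mul_le {t : ℝ} (ht : t ∈ Set.Icc (0 : ℝ) 1) (m : ℕ) (c : ℂ) :
    ‖(t : ℂ) ^ m * (c / m.factorial)‖ ≤ ‖c‖ / m.factorial := by
  rw [norm_mul, norm_pow, Complex.norm_real, Real.norm_eq_abs, abs_of_nonneg ht.1, norm_div,
    Complex.norm_natCast]
  exact mul_le_of_le_one_left (by positivity) (pow_le_one₀ ht.1 ht.2)

lemma integrand_eq (n : ℕ) (k : ℂ) (t : ℝ) (x y z : ℂ) :
    integrand n k t x y z =
      Phi n k z x y / (1 - z * (⟪x, y⟫_ℝ : ℂ)) * (Complex.exp (t / z) / z) := by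
  rw [integrand, mul_comm z, ← div_div]
  ring

/-! ### Taylor expansion of the kernel and termwise integration. -/

/-- The Taylor coefficients of `t ↦ kernelK n k t ρ x y`, up to factorials. -/
def kernelCoeff (n : ℕ) (k x y : ℂ) (m : ℕ) : ℂ :=
  gam n k * ((ascPochhammer ℂ m).eval (1 + gam n k) * dunklE n k m x y)

section Representation

variable {n : ℕ} [NeZero n] {k : ℂ} {δ : ℝ} {x y : ℂ} {ρ : ℝ}

lemma continuousOn_Phi_div (hδ : δ ∈ admissible n k) (hρ : 0 < ρ)
    (hρa : ρ * (δ * a n x y) < 1) :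
    ContinuousOn (fun z => Phi n k z x y / (1 - z * (⟪x, y⟫_ℝ : ℂ))) (Metric.sphere 0 ρ) := by
  have h := hasSum_Phi_div hδ.1 hρ hρa (hδ.2 x y).1
  refine ContinuousOn.congr (continuousOn_tsum (fun m => ?_) h.1 fun m z hz => ?_)
    fun z hz => (h.2 z hz).tsum_eq.symm
  · exact Continuous.continuousOn (by fun_prop)
  · rw [norm_mul, norm_pow, mem_sphere_zero_iff_norm.1 hz]

lemma circleIntegrable_integrand (hδ : δ ∈ admissible n k) (hρ : 0 < ρ)
    (hρa : ρ * (δ * a n x y) < 1) (t : ℝ) : CircleIntegrable (integrand n k t x y) 0 ρ := by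
  have hz0 : ∀ z ∈ Metric.sphere (0 : ℂ) ρ, z ≠ 0 := fun z hz => Metric.ne_of_mem_sphere hz hρ.ne'
  refine ContinuousOn.circleIntegrable hρ.le ?_
  refine ContinuousOn.congr (f := fun z => Phi n k z x y / (1 - z * (⟪x, y⟫_ℝ : ℂ)) *
    (Complex.exp (t / z) / z)) ?_ fun z _ => integrand_eq n k t x y z
  refine (continuousOn_Phi_div hδ hρ hρa).mul (ContinuousOn.div ?_ continuousOn_id hz0)
  exact (ContinuousOn.div continuousOn_const continuousOn_id hz0).cexp

lemma circleIntegral_Phi_div (hγ : 0 < (gam n k).re) (hδ : δ ∈ admissible n k) (hρ : 0 < ρ)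
    (hρa : ρ * (δ * a n x y) < 1) (m : ℕ) :
    kernelCoeff n k x y m = gam n k ^ 2 / (2 * n) * (1 / (2 * Real.pi * Complex.I) *
      ∮ z in C(0, ρ), Phi n k z x y / (1 - z * (⟪x, y⟫_ℝ : ℂ)) / z ^ (m + 1)) := by
  rw [kernelCoeff, (hδ.2 x y).2 ρ hρ hρa m]
  have h1 := pochhammer_ne_zero hγ m
  generalize (1 / (2 * Real.pi * Complex.I) *
      ∮ z in C(0, ρ), Phi n k z x y / (1 - z * (⟪x, y⟫_ℝ : ℂ)) / z ^ (m + 1)) = J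
  have h2 := natCast_ne_zero' n
  field_simp

/-- Cauchy's estimate on the circle of radius `ρ`. Only the contour formula of the given admissible
`δ` enters, so the bound holds for every admissible `δ`. -/
lemma exists_norm_kernelCoeff_le (hγ : 0 < (gam n k).re) (hδ : δ ∈ admissible n k) (hρ : 0 < ρ)
    (hρa : ρ * (δ * a n x y) < 1) :
    ∃ M, ∀ m, ‖kernelCoeff n k x y m‖ ≤ M * (ρ⁻¹) ^ m := by
  obtain ⟨M, hM⟩ := (isCompact_sphere (0 : ℂ) ρ).exists_bound_of_continuousOn
    (continuousOn_Phi_div hδ hρ hρa)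
  refine ⟨‖gam n k ^ 2 / (2 * n)‖ * (‖1 / (2 * Real.pi * Complex.I : ℂ)‖ * (2 * Real.pi * M)),
    fun m => ?_⟩
  have hJ : ‖∮ z in C(0, ρ), Phi n k z x y / (1 - z * (⟪x, y⟫_ℝ : ℂ)) / z ^ (m + 1)‖ ≤
      2 * Real.pi * M * (ρ⁻¹) ^ m := by
    refine (circleIntegral.norm_integral_le_of_norm_le_const (C := M / ρ ^ (m + 1)) hρ.le
      fun z hz => ?_).trans (le_of_eq ?_)
    · rw [norm_div, norm_pow, mem_sphere_zero_iff_norm.1 hz]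
      gcongr
      exact hM z hz
    · rw [pow_succ, inv_pow]
      field_simp
  rw [circleIntegral_Phi_div hγ hδ hρ hρa, norm_mul, norm_mul]
  refine (mul_le_mul_of_nonneg_left (mul_le_mul_of_nonneg_left hJ (norm_nonneg _))
    (norm_nonneg _)).trans (le_of_eq ?_)
  ring

lemma summable_kernelCoeff (hγ : 0 < (gam n k).re) (hδ : δ ∈ admissible n k) (hρ : 0 < ρ)
    (hρa : ρ * (δ * a n x y) < 1) :
    Summable fun m => ‖kernelCoeff n k x y m‖ / m.factorial := by
  obtain ⟨M, hM⟩ := exists_norm_kernelCoeff_le hγ hδ hρ hρa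
  refine Summable.of_nonneg_of_le (fun m => by positivity) (fun m => ?_)
    (summable_bound M ρ⁻¹)
  rw [← mul_div_assoc]
  gcongr
  exact hM m

/-- Expanding `exp (t / z)` under the contour integral produces `t^m / m!` times the integrals that
represent `E_m`; the convergence is uniform because `Φ / (1 - z⟨x, y⟩)` is bounded on the circle. -/
lemma hasSum_kernelK (hγ : 0 < (gam n k).re) (hδ : δ ∈ admissible n k) (hρ : 0 < ρ)
    (hρa : ρ * (δ * a n x y) < 1) (t : ℝ) :
    HasSum (fun m : ℕ => (t : ℂ) ^ m * (kernelCoeff n k x y m / m.factorial))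
      (kernelK n k t ρ x y) := by
  have hz0 : ∀ z ∈ Metric.sphere (0 : ℂ) ρ, z ≠ 0 := fun z hz => Metric.ne_of_mem_sphere hz hρ.ne'
  obtain ⟨M, hM⟩ := (isCompact_sphere (0 : ℂ) ρ).exists_bound_of_continuousOn
    (continuousOn_Phi_div hδ hρ hρa)
  have h := hasSum_circleIntegral hρ.le
    (F := fun m z => ((t : ℂ) ^ m / m.factorial) •
      (Phi n k z x y / (1 - z * (⟪x, y⟫_ℝ : ℂ)) / z ^ (m + 1)))
    (f := integrand n k t x y) (u := fun m => M / ρ * ((|t| / ρ) ^ m / m.factorial))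
    (fun m => ((continuousOn_Phi_div hδ hρ hρa).div (continuousOn_pow (m + 1))
      fun z hz => pow_ne_zero _ (hz0 z hz)).const_smul ((t : ℂ) ^ m / m.factorial))
    (summable_bound _ _)
    (fun m z hz => by
      rw [norm_smul, norm_div, norm_div, norm_pow, norm_pow, mem_sphere_zero_iff_norm.1 hz,
        Complex.norm_real, Real.norm_eq_abs, Complex.norm_natCast]
      calc |t| ^ m / m.factorial * (‖Phi n k z x y / (1 - z * (⟪x, y⟫_ℝ : ℂ))‖ / ρ ^ (m + 1))
          ≤ |t| ^ m / m.factorial * (M / ρ ^ (m + 1)) := by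
            gcongr
            exact hM z hz
        _ = _ := by
            rw [div_pow, pow_succ]
            field_simp)
    (fun z hz => by
      have hexp : HasSum (fun m : ℕ => ((t : ℂ) / z) ^ m / m.factorial) (Complex.exp (t / z)) := by
        rw [Complex.exp_eq_exp_ℂ]
        exact NormedSpace.expSeries_div_hasSum_exp _
      rw [integrand_eq]
      convert! (hexp.div_const z).mul_left _ using 1
      funext m
      rw [smul_eq_mul, div_pow, pow_succ]
      have := hz0 z hz
      field_simp)
  have h2 := (h.mul_left (1 / (2 * Real.pi * Complex.I))).mul_left (gam n k ^ 2 / (2 * n))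
  simp only [circleIntegral.integral_smul] at h2
  convert! h2 using 1
  funext m
  rw [circleIntegral_Phi_div hγ hδ hρ hρa, smul_eq_mul]
  ring

lemma continuousOn_kernelK (hγ : 0 < (gam n k).re) (hδ : δ ∈ admissible n k) (hρ : 0 < ρ)
    (hρa : ρ * (δ * a n x y) < 1) :
    ContinuousOn (fun t : ℝ => kernelK n k t ρ x y) (Set.Icc 0 1) := by
  refine ContinuousOn.congr (continuousOn_tsum (fun m => ?_)
    (summable_kernelCoeff hγ hδ hρ hρa) fun m t ht => norm_pow_mul_le ht m _)
    fun t _ => (hasSum_kernelK hγ hδ hρ hρa t).tsum_eq.symm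
  exact Continuous.continuousOn (by fun_prop)

lemma intervalIntegrable_kernelK (hγ : 0 < (gam n k).re) (hδ : δ ∈ admissible n k) (hρ : 0 < ρ)
    (hρa : ρ * (δ * a n x y) < 1) :
    IntervalIntegrable (fun t : ℝ => (1 - (t : ℂ)) ^ (gam n k - 1) * kernelK n k t ρ x y)
      MeasureTheory.volume 0 1 := by
  refine (intervalIntegrable_one_sub_cpow hγ).mul_continuousOn ?_
  rw [Set.uIcc_of_le zero_le_one]
  exact continuousOn_kernelK hγ hδ hρ hρa

/-- Termwise integration is dominated by `|(1 - t)^(γ - 1)|` times a summable sequence. The Beta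
integral cancels the factor `γ (1 + γ)_m / m!`, so the series becomes `∑ E_m`. -/
lemma dunklKernel_eq_integral (hγ : 0 < (gam n k).re) (hδ : δ ∈ admissible n k) (hρ : 0 < ρ)
    (hρa : ρ * (δ * a n x y) < 1) :
    dunklKernel n k x y =
      ∫ t in (0 : ℝ)..1, (1 - (t : ℂ)) ^ (gam n k - 1) * kernelK n k t ρ x y := by
  have hint := intervalIntegrable_one_sub_cpow hγ
  have hsum := summable_kernelCoeff hγ hδ hρ hρa
  have h := intervalIntegral.hasSum_integral_of_dominated_convergence
    (μ := MeasureTheory.volume) (a := 0) (b := 1)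
    (F := fun (m : ℕ) (t : ℝ) => (1 - (t : ℂ)) ^ (gam n k - 1) *
      ((t : ℂ) ^ m * (kernelCoeff n k x y m / m.factorial)))
    (f := fun t => (1 - (t : ℂ)) ^ (gam n k - 1) * kernelK n k t ρ x y)
    (fun m t => ‖(1 - (t : ℂ)) ^ (gam n k - 1)‖ * (‖kernelCoeff n k x y m‖ / m.factorial))
    (fun m => by
      rw [Set.uIoc_of_le zero_le_one]
      refine hint.1.aestronglyMeasurable.mul (Continuous.aestronglyMeasurable ?_)
      fun_prop)
    (fun m => Filter.Eventually.of_forall fun t ht => by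
      rw [Set.uIoc_of_le zero_le_one] at ht
      rw [norm_mul]
      gcongr
      exact norm_pow_mul_le ⟨ht.1.le, ht.2⟩ m _)
    (Filter.Eventually.of_forall fun t _ => hsum.mul_left _)
    (by
      simp only [tsum_mul_left]
      exact hint.norm.mul_const _)
    (Filter.Eventually.of_forall fun t _ => (hasSum_kernelK hγ hδ hρ hρa t).mul_left _)
  refine (hasSum_dunklKernel hγ x y).unique ?_
  convert! h using 1
  funext m
  simp only [← mul_assoc]
  rw [intervalIntegral.integral_mul_const, integral_beta hγ, kernelCoeff]
  have h1 := pochhammer_ne_zero hγ m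
  have h2 := gam_ne_zero hγ
  have h3 : (m.factorial : ℂ) ≠ 0 := Nat.cast_ne_zero.2 m.factorial_ne_zero
  field_simp

end Representation

end Dunkl

end

theorem mainTheorem2 (n : ℕ) (hn : 2 ≤ n) (k : ℂ) (hγ : 0 < (Dunkl.gam n k).re) :
    (∃! V : MvPolynomial (Fin 2) ℂ →ₗ[ℂ] MvPolynomial (Fin 2) ℂ, Dunkl.IsIntertwining n k V) ∧
    (∀ y : ℂ, ∃! f : ℂ → ℂ, Dunkl.IsDunklKernel n k y f) ∧
    (Dunkl.admissible n k).Nonempty ∧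
    IsUpperSet (Dunkl.admissible n k) ∧
    ∀ δ ∈ Dunkl.admissible n k, ∀ x y : ℂ, ∀ ρ : ℝ, 0 < ρ → ρ * (δ * Dunkl.a n x y) < 1 →
      (∀ t : ℝ, CircleIntegrable (Dunkl.integrand n k t x y) 0 ρ) ∧
      IntervalIntegrable
        (fun t : ℝ => (1 - (t : ℂ)) ^ (Dunkl.gam n k - 1) * Dunkl.kernelK n k t ρ x y)
        MeasureTheory.volume 0 1 ∧
      Dunkl.dunklKernel n k x y =
        ∫ t in (0 : ℝ)..1,
          (1 - (t : ℂ)) ^ (Dunkl.gam n k - 1) * Dunkl.kernelK n k t ρ x y := by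
  have : NeZero n := ⟨by omega⟩
  obtain ⟨V, hV⟩ := Dunkl.exists_isIntertwining hγ
  refine ⟨⟨V, hV, fun V' hV' => hV'.unique hγ hV⟩, Dunkl.existsUnique_isDunklKernel hγ,
    Dunkl.admissible_nonempty hγ, Dunkl.admissible_isUpperSet n k, fun δ hδ x y ρ hρ hρa => ?_⟩
  exact ⟨Dunkl.circleIntegrable_integrand hδ hρ hρa,
    Dunkl.intervalIntegrable_kernelK hγ hδ hρ hρa, Dunkl.dunklKernel_eq_integral hγ hδ hρ hρa⟩
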